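/- Let $m\ge 1$ be an integer, let $p_0,\dots,p_m>0$ with $\sum_i p_i=1$, and let $\zeta_m$ be the random noble means substitution on $\{a,b\}$: each letter $a$ is replaced, independently of all other letters, by $a^i b a^{m-i}$ with probability $p_i$ ($0\le i\le m$), and each $b$ is replaced by $a$. Let $S$ be the shift on $\{a,b\}^{\mathbb Z}$, $(Sx)_k=x_{k+1}$. Let $\mathbb X_m\subset\{a,b\}^{\mathbb Z}$ be the hull of $\zeta_m$, i.e. the smallest closed shift-invariant set that contains all accumulation points of sequences $\bigl(S^{j_n}\zeta_m^n(a|a)\bigr)_{n}$, where $j_n\in\mathbb Z$ and arbitrary realisations of the random words $\zeta_m^n(a|a)$ are allowed. For $\ell\ge1$ let $\mathcal D_{m,\ell}$ be the set of legal words of length $\ell$ (subwords of realisations of $\zeta_m^k(a)$, $k\ge 1$), and let $M_{m,\ell}$ be the matrix of the induced substitution: for $v,w\in\mathcal D_{m,\ell}$, the entry $(v,w)$ is the expected number of positions $0\le k\le|\zeta_m(w_0)|-1$ at which $v$ occurs in $\zeta_m(w)$, where $w_0$ is the first letter of $w$. Let $\lambda_m=\frac12\bigl(m+\sqrt{m^2+4}\bigr)$.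 Then: 1. For every $\ell\ge1$, there is exactly one strictly positive vector $\phi^{(\ell)}$ with $M_{m,\ell}\,\phi^{(\ell)}=\lambda_m\phi^{(\ell)}$ and $\sum_{v}\phi^{(\ell)}(v)=1$. 2. There is exactly one probability measure $\mu$ on $\mathbb X_m$ such that $$\mu\bigl(\{x\in\mathbb X_m : x_{[k,k+\ell-1]}=v\}\bigr)=\phi^{(\ell)}(v)\qquad\text{for all }\ell\ge1,\ k\in\mathbb Z,\ v\in\mathcal D_{m,\ell},$$ and $\mu$ is shift-invariant. 3. For every (real- or complex-valued) $f\in L^1(\mathbb X_m,\mu)$ and every fixed $s\in\mathbb Z$, $$\lim_{N\to\infty}\frac1N\sum_{i=s}^{N+s-1}f(S^ix)=\int_{\mathbb X_m}f\,\mathrm d\mu\qquad\text{for }\mu\text{-almost every }x\in\mathbb X_m.$$ 4. In particular, the entries of $\phi^{(\ell)}$ are the word frequencies: for all $\ell\ge1$, $v\in\mathcal D_{m,\ell}$ and $s\in\mathbb Z$, for $\mu$-almost every $x\in\mathbb X_m$, $$\lim_{N\to\infty}\frac1N\,\#\{\,s\le i\le N+s-1 : x_{[i,i+\ell-1]}=v\,\}=\phi^{(\ell)}(v).$$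 -/

import Mathlib

open Filter Topology MeasureTheory

noncomputable section

namespace RNMS

/-- The two-letter alphabet. -/
inductive Letter where
  | a : Letter
  | b : Letter
deriving DecidableEq

instance : Fintype Letter := ⟨{.a, .b}, fun x => by cases x <;> simp⟩

/-- Finite words. -/
abbrev Word := List Letter

instance : TopologicalSpace Letter := ⊥
instance : DiscreteTopology Letter := ⟨rfl⟩
instance : MeasurableSpace Letter := ⊤
instance : DiscreteMeasurableSpace Letter := ⟨fun _ => trivial⟩

/-- The noble means substitution `ζ_{m,i}`, `0 ≤ i ≤ m`: `a ↦ aⁱ b aᵐ⁻ⁱ`, `b ↦ a`. -/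
def nms (m i : ℕ) : Letter → Word
  | .a => List.replicate i .a ++ [.b] ++ List.replicate (m - i) .a
  | .b => [.a]

/-- The length of the image of a letter (the same for every `ζ_{m,i}`). -/
def imageLength (m : ℕ) : Letter → ℕ
  | .a => m + 1
  | .b => 1

/-- The realisations of `ζ_m(w)`: the index `i` is chosen separately at each letter. When all
probabilities `p_i` are positive, these are the words attained with positive probability. -/
def realisations (m : ℕ) : Word → Set Word
  | [] => {[]}
  | c :: w => {u | ∃ i ≤ m, ∃ v ∈ realisations m w, u = nms m i c ++ v}

/-- The realisations of `ζ_m^n(w)`. -/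
def iterRealisations (m : ℕ) : ℕ → Word → Set Word
  | 0, w => {w}
  | n + 1, w => {u | ∃ v ∈ iterRealisations m n w, u ∈ realisations m v}

/-- The expectation `𝔼[F (ζ_m(w))]` for the random substitution with probability vector `p`: each
letter `a` of `w` is independently replaced by `ζ_{m,i}(a)` with probability `p i`, each `b`
by `a`. -/
def expectImage {m : ℕ} (p : Fin (m + 1) → ℝ) : Word → (Word → ℝ) → ℝ
  | [], F => F []
  | .a :: w, F => ∑ i : Fin (m + 1), p i * expectImage p w (fun v => F (nms m i .a ++ v))
  | .b :: w, F => expectImage p w (fun v => F (nms m 0 .b ++ v))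

/-- A word is legal if it is a subword of a realisation of some power `ζ_m^k(a)`, `k ≥ 1`. -/
def Legal (m : ℕ) (w : Word) : Prop :=
  ∃ k : ℕ, 1 ≤ k ∧ ∃ u ∈ iterRealisations m k [.a], w <:+: u

/-- `𝒟_{m,ℓ}`: the legal words of length `ℓ`. -/
abbrev LegalWord (m ℓ : ℕ) := {w : Fin ℓ → Letter // Legal m (List.ofFn w)}

instance (m ℓ : ℕ) : Fintype (LegalWord m ℓ) := Fintype.ofFinite _

/-- For a word `w` and a realisation `u` of `ζ_m(w)`: the number of positions `k` with
`0 ≤ k ≤ |ζ_m(w₀)| - 1` at which the subword of `u` of length `|v|` equals `v`. -/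
def inducedCount (m : ℕ) (w u v : Word) : ℕ :=
  match w with
  | [] => 0
  | c :: _ => ((Finset.range (imageLength m c)).filter
      (fun k => (u.drop k).take v.length = v)).card

/-- The matrix `M_{m,ℓ}` of the induced substitution: the entry `(v, w)` is the expected number of
occurrences of `v` in the image of `w` under the induced substitution. -/
def inducedMatrix {m : ℕ} (p : Fin (m + 1) → ℝ) (ℓ : ℕ) :
    Matrix (LegalWord m ℓ) (LegalWord m ℓ) ℝ :=
  fun v w => expectImage p (List.ofFn w.1)
    (fun u => (inducedCount m (List.ofFn w.1) u (List.ofFn v.1) : ℝ))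

/-- The inflation multiplier `λ_m = (m + √(m² + 4)) / 2`. -/
def inflation (m : ℕ) : ℝ := ((m : ℝ) + Real.sqrt ((m : ℝ) ^ 2 + 4)) / 2

/-- `φ` is the statistically normalised (entries summing to `1`), strictly positive right
eigenvector of `M_{m,ℓ}` for the eigenvalue `λ_m`. -/
structure IsPFVector {m : ℕ} (p : Fin (m + 1) → ℝ) (ℓ : ℕ) (φ : LegalWord m ℓ → ℝ) : Prop where
  pos : ∀ v, 0 < φ v
  sum_eq_one : ∑ v, φ v = 1
  eigen : (inducedMatrix p ℓ).mulVec φ = inflation m • φ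

/-- The (left) shift `S` on two-sided sequences, `(S x)_k = x_{k+1}`. -/
def shift : Equiv.Perm (ℤ → Letter) where
  toFun x := fun k => x (k + 1)
  invFun x := fun k => x (k - 1)
  left_inv x := by funext k; simp
  right_inv x := by funext k; simp

/-- The letter at position `i` of the marked finite word `u|v`; the first letter of `v` is at
position `0`. It is `none` outside the word. -/
def markedLetter (u v : Word) (i : ℤ) : Option Letter :=
  if 0 ≤ i + u.length then (u ++ v)[(i + u.length).toNat]? else none

/-- The accumulation points of the sequences `(S^{j_n} ζ_m^n(a|a))_n`, for arbitrary shifts `j_n` and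
realisations `u_n|v_n` of `ζ_m^n(a|a)`: arbitrarily large central windows agree with the shifted
finite word for infinitely many `n`. -/
def accPoints (m : ℕ) : Set (ℤ → Letter) :=
  {x | ∃ (j : ℕ → ℤ) (u v : ℕ → Word),
    (∀ n, u n ∈ iterRealisations m n [.a] ∧ v n ∈ iterRealisations m n [.a]) ∧
    ∀ r : ℤ, ∃ᶠ n in atTop, ∀ i : ℤ, |i| ≤ r → markedLetter (u n) (v n) (i + j n) = some (x i)}

/-- The two-sided discrete hull `𝕏_m`: the smallest closed and shift-invariant set that contains
all these accumulation points. -/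
def hull (m : ℕ) : Set (ℤ → Letter) :=
  ⋂₀ {Y | IsClosed Y ∧ shift ⁻¹' Y = Y ∧ accPoints m ⊆ Y}

theorem mem_hull_iff_shift (m : ℕ) (x : ℤ → Letter) : shift x ∈ hull m ↔ x ∈ hull m := by
  simp only [hull, Set.mem_sInter, Set.mem_ofPred_eq]
  refine forall_congr' fun Y => forall_congr' fun hY => ?_
  rw [← Set.mem_preimage, hY.2.1]

/-- The shift as a bijection of the hull. -/
def hullShift (m : ℕ) : Equiv.Perm (hull m) :=
  shift.subtypePerm (fun x => mem_hull_iff_shift m x)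

/-- The cylinder set `Z_k(v)` of all `x ∈ 𝕏_m` with `x_{[k,k+ℓ-1]} = v`. -/
def cylinder (m : ℕ) {ℓ : ℕ} (k : ℤ) (v : Fin ℓ → Letter) : Set (hull m) :=
  {x | ∀ i : Fin ℓ, x.1 (k + (i : ℤ)) = v i}

/-- `μ` is the probability measure on the hull whose values on cylinder sets are the entries of the
normalised Perron–Frobenius eigenvectors. -/
structure IsPFMeasure {m : ℕ} (p : Fin (m + 1) → ℝ) (μ : Measure (hull m)) : Prop where
  prob : IsProbabilityMeasure μ
  cylinder_eq : ∀ ℓ : ℕ, 1 ≤ ℓ → ∃ φ : LegalWord m ℓ → ℝ, IsPFVector p ℓ φ ∧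
    ∀ (k : ℤ) (v : LegalWord m ℓ), μ (cylinder m k v.1) = ENNReal.ofReal (φ v)

end RNMS

end

open RNMS

open Filter Topology MeasureTheory

noncomputable section

namespace RNMS

section

/-! ### Images of words under the random substitution -/

/-! All realisations of the image of a letter are rearrangements of one word, so lengths and letter
counts of images are not random. Hence the left eigenvector `(λ, 1)` of the substitution matrix,
read off the first letter of a word, is a positive left eigenvector of every induced matrix, with
eigenvalue `λ`. These matrices are primitive because a legal word occurs in realisations of every
high level. Rescaling by the left eigenvector gives a stochastic matrix that contracts vectors of
sum zero. This yields a unique normalised eigenvector and the convergence of `Mⁿ / λⁿ` to a rank-one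
projection (`exists_perron`, `existsUnique_eigenvector`).

The eigenvectors of different lengths are consistent. Forgetting the last letter maps normalised
eigenvectors to normalised eigenvectors, and uniqueness identifies the result (`wordMean_take`).
Forgetting the first letter gives the same marginal, because the difference of the two marginals
shrinks by `1 / λ` under each renormalisation (`wordMean_tail`). A weak limit of finitely supported
measures then has the prescribed cylinder values. It lives on the hull, since a sequence with legal
central windows is an accumulation point. Cylinders determine the measure, and shift-invariance
follows from this uniqueness.

The main point is ergodicity, which rests on an `L¹` law of large numbers for word counts
(`wordMean_abs_blockSum_le`). View a random legal word as a window of the random image of another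
one. A sum of `f` over its subwords is, up to boundary terms, a sum over the image of a prefix.
Given the preimage, its mean is a sum of `inducedMap f` over that prefix, and by Efron–Stein its
fluctuation is of order `√L`. After `n` such steps `f` is replaced by its `n`-th transposed iterate,
which is `o(λⁿ)` when `f` has mean zero, while the number of summands falls by the factor `λⁿ`. With
`n` fixed and the length growing, the sum is `o(N)` in mean. Prefixes are cut by weight rather than
by length, because weights transform exactly under the substitution.

The law of large numbers makes every invariant set independent of all cylinders, hence of itself.
Birkhoff's theorem, proved here for ergodic maps by a maximal-function argument, gives the pointwise
averages, and indicators of cylinders give the frequencies. -/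

theorem length_nms {m i : ℕ} (hi : i ≤ m) (c : Letter) : (nms m i c).length = imageLength m c := by
  cases c <;> simp [nms, imageLength]; omega

theorem imageLength_pos (m : ℕ) (c : Letter) : 1 ≤ imageLength m c := by
  cases c <;> simp [imageLength]

/-- The sum of a weight function over the letters of a word. -/
def weight (c : Letter → ℝ) (w : Word) : ℝ := (w.map c).sum

@[simp] theorem weight_nil (c : Letter → ℝ) : weight c [] = 0 := rfl

@[simp] theorem weight_cons (c : Letter → ℝ) (x : Letter) (w : Word) :
    weight c (x :: w) = c x + weight c w := by simp [weight]

@[simp] theorem weight_append (c : Letter → ℝ) (w w' : Word) :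
    weight c (w ++ w') = weight c w + weight c w' := by simp [weight]

/-- The total length of the images of the letters of a word. -/
def imageLen (m : ℕ) (w : Word) : ℕ := (w.map (imageLength m)).sum

@[simp] theorem imageLen_nil (m : ℕ) : imageLen m [] = 0 := rfl

@[simp] theorem imageLen_cons (m : ℕ) (x : Letter) (w : Word) :
    imageLen m (x :: w) = imageLength m x + imageLen m w := by simp [imageLen]

@[simp] theorem imageLen_append (m : ℕ) (w w' : Word) :
    imageLen m (w ++ w') = imageLen m w + imageLen m w' := by simp [imageLen]

theorem length_le_imageLen (m : ℕ) (w : Word) : w.length ≤ imageLen m w := by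
  induction w with
  | nil => simp
  | cons c w ih => have := imageLength_pos m c; simp; omega

/-- The transpose of the substitution matrix, acting on weights. -/
def pullWeight (m : ℕ) (c : Letter → ℝ) : Letter → ℝ
  | .a => m * c .a + c .b
  | .b => c .a

/-- The index only moves the letter `b` within the image, so a weight does not see the random
choice. The cutting argument for ergodicity depends on this. -/
theorem weight_nms {m i : ℕ} (hi : i ≤ m) (c : Letter → ℝ) (x : Letter) :
    weight c (nms m i x) = pullWeight m c x := by
  cases x
  · simp only [nms, pullWeight, weight, List.map_append, List.map_replicate, List.sum_append,
      List.sum_replicate, List.map_cons, List.map_nil, List.sum_cons, List.sum_nil, nsmul_eq_mul]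
    rw [Nat.cast_sub hi]; ring
  · simp [nms, pullWeight, weight]

theorem realisations_append {m : ℕ} {w w' u : Word} :
    u ∈ realisations m (w ++ w') ↔
      ∃ u₁ ∈ realisations m w, ∃ u₂ ∈ realisations m w', u = u₁ ++ u₂ := by
  induction w generalizing u with
  | nil => simp [realisations]
  | cons c w ih =>
    constructor
    · rintro ⟨i, hi, v, hv, rfl⟩
      obtain ⟨v₁, h₁, v₂, h₂, rfl⟩ := ih.1 hv
      exact ⟨_, ⟨i, hi, v₁, h₁, rfl⟩, v₂, h₂, by simp⟩
    · rintro ⟨_, ⟨i, hi, v₁, h₁, rfl⟩, v₂, h₂, rfl⟩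
      exact ⟨i, hi, v₁ ++ v₂, ih.2 ⟨v₁, h₁, v₂, h₂, rfl⟩, by simp⟩

theorem realisations_singleton {m i : ℕ} (hi : i ≤ m) (c : Letter) :
    nms m i c ∈ realisations m [c] := ⟨i, hi, [], rfl, by simp⟩

theorem realisations_nonempty (m : ℕ) (w : Word) : (realisations m w).Nonempty := by
  induction w with
  | nil => exact ⟨[], rfl⟩
  | cons c w ih => obtain ⟨v, hv⟩ := ih; exact ⟨_, 0, Nat.zero_le _, v, hv, rfl⟩

theorem length_of_mem_realisations {m : ℕ} {w u : Word} (hu : u ∈ realisations m w) :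
    u.length = imageLen m w := by
  induction w generalizing u with
  | nil => simp only [realisations, Set.mem_singleton_iff] at hu; simp [hu]
  | cons c w ih =>
    obtain ⟨i, hi, v, hv, rfl⟩ := hu
    simp [length_nms hi, ih hv]

theorem weight_of_mem_realisations {m : ℕ} {w u : Word} (c : Letter → ℝ)
    (hu : u ∈ realisations m w) : weight c u = weight (pullWeight m c) w := by
  induction w generalizing u with
  | nil => simp only [realisations, Set.mem_singleton_iff] at hu; simp [hu]
  | cons x w ih =>
    obtain ⟨i, hi, v, hv, rfl⟩ := hu
    simp [weight_nms hi, ih hv]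

/-! ### The expectation over the images -/

section Expect

variable {m : ℕ} (p : Fin (m + 1) → ℝ)

theorem expectImage_add (w : Word) (F G : Word → ℝ) :
    expectImage p w (fun u => F u + G u) = expectImage p w F + expectImage p w G := by
  induction w generalizing F G with
  | nil => rfl
  | cons c w ih =>
    cases c
    · simp only [expectImage, ih, mul_add, Finset.sum_add_distrib]
    · simp only [expectImage, ih]

theorem expectImage_const_mul (w : Word) (r : ℝ) (F : Word → ℝ) :
    expectImage p w (fun u => r * F u) = r * expectImage p w F := by
  induction w generalizing F with
  | nil => rfl
  | cons c w ih =>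
    cases c
    · simp only [expectImage, ih, Finset.mul_sum]
      exact Finset.sum_congr rfl fun i _ => by ring
    · simp only [expectImage, ih]

theorem expectImage_sub (w : Word) (F G : Word → ℝ) :
    expectImage p w (fun u => F u - G u) = expectImage p w F - expectImage p w G := by
  have h := expectImage_add p w F (fun u => (-1) * G u)
  rw [expectImage_const_mul] at h
  simpa [sub_eq_add_neg] using h

theorem expectImage_sum {ι : Type*} (s : Finset ι) (w : Word) (F : ι → Word → ℝ) :
    expectImage p w (fun u => ∑ i ∈ s, F i u) = ∑ i ∈ s, expectImage p w (F i) := by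
  classical
  induction s using Finset.induction_on with
  | empty => simpa using expectImage_const_mul p w 0 (fun _ => 0)
  | insert i s hi ih => simp only [Finset.sum_insert hi, expectImage_add, ih]

theorem expectImage_append (w w' : Word) (F : Word → ℝ) :
    expectImage p (w ++ w') F =
      expectImage p w (fun u => expectImage p w' (fun u' => F (u ++ u'))) := by
  induction w generalizing F with
  | nil => rfl
  | cons c w ih => cases c <;> simp only [List.cons_append, expectImage, ih, List.append_assoc]

theorem expectImage_congr {w : Word} {F G : Word → ℝ}
    (h : ∀ u ∈ realisations m w, F u = G u) : expectImage p w F = expectImage p w G := by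
  induction w generalizing F G with
  | nil => exact h [] rfl
  | cons c w ih =>
    cases c
    · simp only [expectImage]
      refine Finset.sum_congr rfl fun i _ => ?_
      rw [ih fun u hu => h _ ⟨i, by omega, u, hu, rfl⟩]
    · simp only [expectImage]
      exact ih fun u hu => h _ ⟨0, by omega, u, hu, rfl⟩

variable {p} (hp : ∀ i, 0 < p i) (hsum : ∑ i, p i = 1)

include hp in
theorem expectImage_mono {w : Word} {F G : Word → ℝ}
    (h : ∀ u ∈ realisations m w, F u ≤ G u) : expectImage p w F ≤ expectImage p w G := by
  induction w generalizing F G with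
  | nil => exact h [] rfl
  | cons c w ih =>
    cases c
    · simp only [expectImage]
      exact Finset.sum_le_sum fun i _ =>
        mul_le_mul_of_nonneg_left (ih fun u hu => h _ ⟨i, by omega, u, hu, rfl⟩) (hp i).le
    · simp only [expectImage]
      exact ih fun u hu => h _ ⟨0, by omega, u, hu, rfl⟩

include hsum in
theorem expectImage_const (w : Word) (r : ℝ) : expectImage p w (fun _ => r) = r := by
  induction w with
  | nil => rfl
  | cons c w ih =>
    cases c
    · simp only [expectImage, ih]
      rw [← Finset.sum_mul, hsum, one_mul]
    · simp only [expectImage, ih]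

include hp hsum in
theorem expectImage_nonneg {w : Word} {F : Word → ℝ}
    (h : ∀ u ∈ realisations m w, 0 ≤ F u) : 0 ≤ expectImage p w F := by
  have := expectImage_mono hp h
  rwa [expectImage_const hsum] at this

include hp hsum in
theorem expectImage_pos {w : Word} {F : Word → ℝ}
    (h : ∀ u ∈ realisations m w, 0 ≤ F u) {u₀ : Word} (hu₀ : u₀ ∈ realisations m w)
    (h₀ : 0 < F u₀) : 0 < expectImage p w F := by
  induction w generalizing F u₀ with
  | nil => simp only [realisations, Set.mem_singleton_iff] at hu₀; subst hu₀; exact h₀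
  | cons c w ih =>
    obtain ⟨i, hi, v, hv, rfl⟩ := hu₀
    cases c
    · simp only [expectImage]
      refine Finset.sum_pos' (fun j _ => mul_nonneg (hp j).le
        (expectImage_nonneg hp hsum fun u hu => h _ ⟨j, by omega, u, hu, rfl⟩))
        ⟨⟨i, by omega⟩, Finset.mem_univ _, mul_pos (hp _)
          (ih (fun u hu => h _ ⟨i, by omega, u, hu, rfl⟩) hv h₀)⟩
    · simp only [expectImage]
      exact ih (fun u hu => h _ ⟨0, by omega, u, hu, rfl⟩) hv h₀

include hp in
theorem abs_expectImage_le {w : Word} {F : Word → ℝ} :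
    |expectImage p w F| ≤ expectImage p w (fun u => |F u|) := by
  rw [abs_le]
  constructor
  · have := expectImage_mono hp (w := w) (F := fun u => (-1) * |F u|) (G := F)
      fun u _ => by have := neg_abs_le (F u); linarith
    rw [expectImage_const_mul] at this; linarith
  · exact expectImage_mono hp fun u _ => le_abs_self _

end Expect

end

section

/-! ### Perron–Frobenius theory for a matrix with a positive left eigenvector -/

section Stochastic

variable {ι : Type*} [Fintype ι]

/-- The `ℓ¹`-norm of a vector. -/
def lOne (x : ι → ℝ) : ℝ := ∑ v, |x v|

theorem lOne_nonneg (x : ι → ℝ) : 0 ≤ lOne x := Finset.sum_nonneg fun _ _ => abs_nonneg _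

theorem sum_mulVec_of_colSum {Q : Matrix ι ι ℝ} {r : ℝ} (hcol : ∀ w, ∑ v, Q v w = r)
    (x : ι → ℝ) : ∑ v, Q.mulVec x v = r * ∑ v, x v := by
  simp only [Matrix.mulVec, dotProduct]
  rw [Finset.sum_comm, Finset.mul_sum]
  refine Finset.sum_congr rfl fun w _ => ?_
  rw [← Finset.sum_mul, hcol]

theorem abs_mulVec_le {Q : Matrix ι ι ℝ} (hQ : ∀ v w, 0 ≤ Q v w) (x : ι → ℝ) (v : ι) :
    |Q.mulVec x v| ≤ Q.mulVec (fun w => |x w|) v := by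
  simp only [Matrix.mulVec, dotProduct]
  refine (Finset.abs_sum_le_sum_abs _ _).trans (Finset.sum_le_sum fun w _ => ?_)
  rw [abs_mul, abs_of_nonneg (hQ v w)]

theorem lOne_mulVec_le {Q : Matrix ι ι ℝ} {r : ℝ} (hQ : ∀ v w, 0 ≤ Q v w)
    (hcol : ∀ w, ∑ v, Q v w = r) (x : ι → ℝ) : lOne (Q.mulVec x) ≤ r * lOne x := by
  unfold lOne
  rw [← sum_mulVec_of_colSum hcol]
  exact Finset.sum_le_sum fun v _ => abs_mulVec_le hQ x v

variable [DecidableEq ι]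

theorem pow_nonneg_entries {Q : Matrix ι ι ℝ} (hQ : ∀ v w, 0 ≤ Q v w) (n : ℕ) (v w : ι) :
    0 ≤ (Q ^ n) v w := by
  induction n generalizing v w with
  | zero => simp only [pow_zero, Matrix.one_apply]; split_ifs <;> norm_num
  | succ n ih =>
    rw [pow_succ, Matrix.mul_apply]
    exact Finset.sum_nonneg fun j _ => mul_nonneg (ih _ _) (hQ _ _)

theorem pow_colSum {Q : Matrix ι ι ℝ} (hcol : ∀ w, ∑ v, Q v w = 1) (n : ℕ) (w : ι) :
    ∑ v, (Q ^ n) v w = 1 := by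
  induction n generalizing w with
  | zero => simp [Matrix.one_apply]
  | succ n ih =>
    simp only [pow_succ, Matrix.mul_apply]
    rw [Finset.sum_comm]
    simp only [← Finset.sum_mul, ih, one_mul, hcol]

/-- The constant row is a left fixed vector, so `Q - 1` is singular and has a real right fixed
vector `x`. Then `|x| ≤ Q |x|` entrywise while both sides have the same total, so `|x|` is fixed
too. A positive power makes all its entries positive. -/
theorem exists_stationary [Nonempty ι] {Q : Matrix ι ι ℝ} (hQ : ∀ v w, 0 ≤ Q v w)
    (hcol : ∀ w, ∑ v, Q v w = 1) {k : ℕ} (hk : ∀ v w, 0 < (Q ^ k) v w) :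
    ∃ π : ι → ℝ, (∀ v, 0 < π v) ∧ ∑ v, π v = 1 ∧ Q.mulVec π = π := by
  have hdet : (Q - 1).det = 0 := by
    rw [← Matrix.exists_vecMul_eq_zero_iff]
    refine ⟨fun _ => 1, fun h => one_ne_zero (congrFun h (Classical.arbitrary ι)), ?_⟩
    rw [Matrix.vecMul_sub, Matrix.vecMul_one]
    ext w
    simp [Matrix.vecMul, dotProduct, hcol]
  obtain ⟨x, hx0, hx⟩ := Matrix.exists_mulVec_eq_zero_iff.2 hdet
  rw [Matrix.sub_mulVec, Matrix.one_mulVec, sub_eq_zero] at hx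
  set y : ι → ℝ := fun v => |x v| with hy
  have hle : ∀ v, y v ≤ Q.mulVec y v := fun v => by
    have := abs_mulVec_le hQ x v
    rwa [hx] at this
  have hsum : ∑ v, Q.mulVec y v = ∑ v, y v := by rw [sum_mulVec_of_colSum hcol, one_mul]
  have hyQ : Q.mulVec y = y := by
    ext v
    have := (Finset.sum_eq_sum_iff_of_le fun v _ => hle v).1 hsum.symm v (Finset.mem_univ _)
    exact this.symm
  have hpow : ∀ n : ℕ, (Q ^ n).mulVec y = y := by
    intro n
    induction n with
    | zero => simp
    | succ n ih => rw [pow_succ, ← Matrix.mulVec_mulVec, hyQ, ih]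
  obtain ⟨w₀, hw₀⟩ : ∃ w, x w ≠ 0 := by
    by_contra! h
    exact hx0 (funext h)
  have hpos : ∀ v, 0 < y v := by
    intro v
    rw [← hpow k]
    exact Finset.sum_pos' (fun w _ => mul_nonneg (hk v w).le (abs_nonneg _))
      ⟨w₀, Finset.mem_univ _, mul_pos (hk v w₀) (abs_pos.2 hw₀)⟩
  have hs : 0 < ∑ v, y v := Finset.sum_pos (fun v _ => hpos v) Finset.univ_nonempty
  refine ⟨fun v => (∑ v, y v)⁻¹ * y v, fun v => mul_pos (inv_pos.2 hs) (hpos v), ?_, ?_⟩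
  · rw [← Finset.mul_sum, inv_mul_cancel₀ hs.ne']
  · have : (fun v => (∑ v, y v)⁻¹ * y v) = (∑ v, y v)⁻¹ • y := rfl
    rw [this, Matrix.mulVec_smul, hyQ]

/-- Doeblin's argument. On vectors of sum zero, `Q ^ k` acts like `Q ^ k` minus a constant matrix.
With the smallest entry as the constant, the difference is still nonnegative but has column sums `r
< 1`. Monotonicity of the norm handles exponents that are not multiples of `k`. -/
theorem tendsto_lOne_pow [Nonempty ι] {Q : Matrix ι ι ℝ} (hQ : ∀ v w, 0 ≤ Q v w)
    (hcol : ∀ w, ∑ v, Q v w = 1) {k : ℕ} (hk : ∀ v w, 0 < (Q ^ k) v w) {x : ι → ℝ}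
    (hx : ∑ v, x v = 0) : Tendsto (fun n => lOne ((Q ^ n).mulVec x)) atTop (𝓝 0) := by
  obtain ⟨⟨v₀, w₀⟩, hmin⟩ := Finite.exists_min (fun q : ι × ι => (Q ^ k) q.1 q.2)
  set δ := (Q ^ k) v₀ w₀ with hδ
  have hδ0 : 0 < δ := hk _ _
  set r : ℝ := 1 - Fintype.card ι * δ with hr
  set R : Matrix ι ι ℝ := Q ^ k - Matrix.of (fun _ _ => δ) with hRdef
  have hR : ∀ v w, 0 ≤ R v w := fun v w => by
    simpa [hRdef] using hmin (v, w)
  have hRcol : ∀ w, ∑ v, R v w = r := fun w => by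
    simp [hRdef, Finset.sum_sub_distrib, pow_colSum hcol, hr]
  have hr0 : 0 ≤ r := by
    rw [← hRcol w₀]; exact Finset.sum_nonneg fun v _ => hR v w₀
  have hr1 : r < 1 := by
    have : 0 < (Fintype.card ι : ℝ) := Nat.cast_pos.2 Fintype.card_pos
    have := mul_pos this hδ0
    linarith
  have hstep : ∀ y : ι → ℝ, ∑ v, y v = 0 → lOne ((Q ^ k).mulVec y) ≤ r * lOne y := by
    intro y hy
    have : (Q ^ k).mulVec y = R.mulVec y := by
      rw [hRdef, Matrix.sub_mulVec]
      ext v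
      simp [Matrix.mulVec, dotProduct, ← Finset.mul_sum, hy]
    rw [this]
    exact lOne_mulVec_le hR hRcol y
  have hzero : ∀ n, ∑ v, (Q ^ n).mulVec x v = 0 := fun n => by
    rw [sum_mulVec_of_colSum (pow_colSum hcol n), hx, mul_zero]
  have hanti : Antitone fun n => lOne ((Q ^ n).mulVec x) := by
    refine antitone_nat_of_succ_le fun n => ?_
    rw [pow_succ', ← Matrix.mulVec_mulVec]
    simpa using lOne_mulVec_le hQ hcol ((Q ^ n).mulVec x)
  have hgeom : ∀ n, lOne ((Q ^ (k * n)).mulVec x) ≤ r ^ n * lOne x := by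
    intro n
    induction n with
    | zero => simp
    | succ n ih =>
      rw [Nat.mul_succ, add_comm, pow_add, ← Matrix.mulVec_mulVec]
      refine (hstep _ (hzero _)).trans ?_
      rw [pow_succ', mul_assoc]
      exact mul_le_mul_of_nonneg_left ih hr0
  rw [Metric.tendsto_atTop]
  intro ε hε
  have hlim : Tendsto (fun n : ℕ => r ^ n * lOne x) atTop (𝓝 (0 * lOne x)) :=
    (tendsto_pow_atTop_nhds_zero_of_lt_one hr0 hr1).mul_const _
  rw [zero_mul] at hlim
  obtain ⟨n, hn⟩ := (hlim.eventually (gt_mem_nhds hε)).exists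
  refine ⟨k * n, fun N hN => ?_⟩
  rw [Real.dist_eq, sub_zero, abs_of_nonneg (lOne_nonneg _)]
  exact (hanti hN).trans_lt ((hgeom n).trans_lt hn)

/-- Perron–Frobenius theorem for a primitive matrix with a positive left eigenvector `H`. -/
theorem exists_perron [Nonempty ι] {M : Matrix ι ι ℝ} {H : ι → ℝ} {lam : ℝ} (hlam : 0 < lam)
    (hM : ∀ v w, 0 ≤ M v w) (hH : ∀ v, 0 < H v) (hleft : ∀ w, ∑ v, H v * M v w = lam * H w)
    {k : ℕ} (hk : ∀ v w, 0 < (M ^ k) v w) :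
    ∃ φ : ι → ℝ, (∀ v, 0 < φ v) ∧ ∑ v, φ v = 1 ∧ M.mulVec φ = lam • φ ∧
      ∀ (f : ι → ℝ) (w : ι), Tendsto (fun n : ℕ => (∑ v, f v * (M ^ n) v w) / lam ^ n) atTop
        (𝓝 ((∑ v, φ v * f v) * H w / ∑ v, φ v * H v)) := by
  -- Conjugation by the diagonal matrix of `H` and division by `lam` turn the left eigenvector into
  -- the constant row, so `Q` is column-stochastic.
  set Q : Matrix ι ι ℝ := Matrix.of fun v w => H v * M v w / (lam * H w) with hQdef
  have hQn : ∀ n v w, (Q ^ n) v w = H v * (M ^ n) v w / (lam ^ n * H w) := by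
    intro n
    induction n with
    | zero =>
      intro v w
      simp only [pow_zero, Matrix.one_apply, one_mul]
      split_ifs with h
      · subst h; rw [mul_one, div_self (hH _).ne']
      · simp
    | succ n ih =>
      intro v w
      simp only [pow_succ, Matrix.mul_apply, Finset.mul_sum, Finset.sum_div, ih]
      refine Finset.sum_congr rfl fun j _ => ?_
      rw [hQdef, Matrix.of_apply]
      have := (hH j).ne'; have := (hH w).ne'
      field_simp
  have hQ : ∀ v w, 0 ≤ Q v w := fun v w =>
    div_nonneg (mul_nonneg (hH v).le (hM v w)) (mul_pos hlam (hH w)).le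
  have hcol : ∀ w, ∑ v, Q v w = 1 := fun w => by
    simp only [hQdef, Matrix.of_apply]
    rw [← Finset.sum_div, hleft, div_self (mul_pos hlam (hH w)).ne']
  have hQk : ∀ v w, 0 < (Q ^ k) v w := fun v w => by
    rw [hQn]; exact div_pos (mul_pos (hH v) (hk v w)) (mul_pos (pow_pos hlam k) (hH w))
  obtain ⟨π, hπ, hπ1, hQπ⟩ := exists_stationary hQ hcol hQk
  have hQπn : ∀ n : ℕ, (Q ^ n).mulVec π = π := by
    intro n
    induction n with
    | zero => simp
    | succ n ih => rw [pow_succ, ← Matrix.mulVec_mulVec, hQπ, ih]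
  have hconv : ∀ v w, Tendsto (fun n => (Q ^ n) v w) atTop (𝓝 (π v)) := by
    intro v w
    have hx : ∑ v, (Pi.single w (1 : ℝ) - π : ι → ℝ) v = 0 := by simp [hπ1]
    have h0 := tendsto_lOne_pow hQ hcol hQk hx
    rw [← tendsto_sub_nhds_zero_iff]
    refine squeeze_zero_norm (fun n => ?_) h0
    have : (Q ^ n) v w - π v = ((Q ^ n).mulVec (Pi.single w (1 : ℝ) - π)) v := by
      rw [Matrix.mulVec_sub, hQπn]; simp
    rw [this, Real.norm_eq_abs]
    exact Finset.single_le_sum (f := fun v => |((Q ^ n).mulVec (Pi.single w (1 : ℝ) - π)) v|)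
      (fun _ _ => abs_nonneg _) (Finset.mem_univ v)
  -- Undoing the conjugation, the eigenvector of `M` is `π / H`; `s` is its total mass, and its
  -- pairing with `H` is `1 / s` after normalisation.
  set s : ℝ := ∑ v, π v / H v with hs
  have hs0 : 0 < s := Finset.sum_pos (fun v _ => div_pos (hπ v) (hH v)) Finset.univ_nonempty
  have hφH : ∑ v, π v / H v / s * H v = 1 / s := by
    rw [← hπ1, Finset.sum_div]
    refine Finset.sum_congr rfl fun v _ => ?_
    have := (hH v).ne'
    field_simp
  refine ⟨fun v => π v / H v / s, fun v => div_pos (div_pos (hπ v) (hH v)) hs0, ?_, ?_, ?_⟩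
  · rw [← Finset.sum_div, div_self hs0.ne']
  · ext v
    have h1 := congrFun hQπ v
    simp only [Matrix.mulVec, dotProduct, hQdef, Matrix.of_apply] at h1
    simp only [Matrix.mulVec, dotProduct, Pi.smul_apply, smul_eq_mul]
    rw [← h1, Finset.sum_div, Finset.sum_div, Finset.mul_sum]
    refine Finset.sum_congr rfl fun w _ => ?_
    have := (hH v).ne'; have := (hH w).ne'
    field_simp
  · intro f w
    have h1 : Tendsto (fun n => ∑ v, f v / H v * H w * (Q ^ n) v w) atTop
        (𝓝 (∑ v, f v / H v * H w * π v)) :=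
      tendsto_finsetSum _ fun v _ => (hconv v w).const_mul _
    rw [hφH]
    convert h1 using 2
    · rename_i n
      rw [Finset.sum_div]
      refine Finset.sum_congr rfl fun v _ => ?_
      rw [hQn]
      have := (hH v).ne'; have := (hH w).ne'
      field_simp
    · rw [Finset.sum_mul, Finset.sum_div]
      refine Finset.sum_congr rfl fun v _ => ?_
      have := (hH v).ne'
      field_simp

end Stochastic

end

section

/-! ### Iterated realisations and legal words -/

theorem iterRealisations_append {m n : ℕ} {w w' u : Word} :
    u ∈ iterRealisations m n (w ++ w') ↔
      ∃ u₁ ∈ iterRealisations m n w, ∃ u₂ ∈ iterRealisations m n w', u = u₁ ++ u₂ := by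
  induction n generalizing u with
  | zero => simp [iterRealisations]
  | succ n ih =>
    constructor
    · rintro ⟨v, hv, hu⟩
      obtain ⟨v₁, h₁, v₂, h₂, rfl⟩ := ih.1 hv
      obtain ⟨u₁, k₁, u₂, k₂, rfl⟩ := realisations_append.1 hu
      exact ⟨u₁, ⟨v₁, h₁, k₁⟩, u₂, ⟨v₂, h₂, k₂⟩, rfl⟩
    · rintro ⟨u₁, ⟨v₁, h₁, k₁⟩, u₂, ⟨v₂, h₂, k₂⟩, rfl⟩
      exact ⟨v₁ ++ v₂, ih.2 ⟨v₁, h₁, v₂, h₂, rfl⟩, realisations_append.2 ⟨u₁, k₁, u₂, k₂, rfl⟩⟩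

theorem iterRealisations_trans {m n k : ℕ} {w v u : Word} (hv : v ∈ iterRealisations m n w)
    (hu : u ∈ iterRealisations m k v) : u ∈ iterRealisations m (n + k) w := by
  induction k generalizing u with
  | zero => simp only [iterRealisations, Set.mem_singleton_iff] at hu; subst hu; exact hv
  | succ k ih => obtain ⟨x, hx, hux⟩ := hu; exact ⟨x, ih hx, hux⟩

theorem iterRealisations_one {m : ℕ} {w u : Word} (hu : u ∈ realisations m w) :
    u ∈ iterRealisations m 1 w := ⟨w, rfl, hu⟩

theorem iterRealisations_nonempty (m n : ℕ) (w : Word) : (iterRealisations m n w).Nonempty := by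
  induction n with
  | zero => exact ⟨w, rfl⟩
  | succ n ih =>
    obtain ⟨v, hv⟩ := ih
    obtain ⟨u, hu⟩ := realisations_nonempty m v
    exact ⟨u, v, hv, hu⟩

theorem iterRealisations_infix {m n : ℕ} {w w' u : Word} (h : w <:+: w')
    (hu : u ∈ iterRealisations m n w) : ∃ u' ∈ iterRealisations m n w', u <:+: u' := by
  obtain ⟨s, t, rfl⟩ := h
  obtain ⟨s', hs'⟩ := iterRealisations_nonempty m n s
  obtain ⟨t', ht'⟩ := iterRealisations_nonempty m n t
  exact ⟨s' ++ u ++ t', iterRealisations_append.2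
    ⟨s' ++ u, iterRealisations_append.2 ⟨s', hs', u, hu, rfl⟩, t', ht', rfl⟩, s', t', rfl⟩

theorem ne_nil_of_mem_iterRealisations {m n : ℕ} {w u : Word} (hw : w ≠ [])
    (hu : u ∈ iterRealisations m n w) : u ≠ [] := by
  induction n generalizing u with
  | zero => simp only [iterRealisations, Set.mem_singleton_iff] at hu; subst hu; exact hw
  | succ n ih =>
    obtain ⟨v, hv, hu⟩ := hu
    have h1 := length_of_mem_realisations hu
    have h2 := length_le_imageLen m v
    have h3 := List.length_pos_iff.2 (ih hv)
    exact List.length_pos_iff.1 (by omega)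

theorem Legal.of_infix {m : ℕ} {w w' : Word} (h : Legal m w') (hw : w <:+: w') : Legal m w := by
  obtain ⟨k, hk, u, hu, hi⟩ := h
  exact ⟨k, hk, u, hu, hw.trans hi⟩

theorem Legal.image {m : ℕ} {w u : Word} (h : Legal m w) (hu : u ∈ realisations m w) :
    Legal m u := by
  obtain ⟨k, hk, v, hv, hi⟩ := h
  obtain ⟨u', hu', hi'⟩ := iterRealisations_infix hi (iterRealisations_one hu)
  exact ⟨k + 1, by omega, u', iterRealisations_trans hv hu', hi'⟩

variable {m : ℕ} (hm : 1 ≤ m)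

include hm in
theorem a_infix_nms : [Letter.a] <:+: nms m 0 .a :=
  ⟨[.b], List.replicate (m - 1) .a, by
    obtain ⟨k, rfl⟩ : ∃ k, m = k + 1 := ⟨m - 1, by omega⟩
    simp [nms, List.replicate_succ]⟩

include hm in
theorem exists_infix_succ {n : ℕ} {u : Word} (hu : u ∈ iterRealisations m n [.a]) :
    ∃ u' ∈ iterRealisations m (n + 1) [.a], u <:+: u' := by
  obtain ⟨u', hu', hi⟩ := iterRealisations_infix (a_infix_nms hm) hu
  have := iterRealisations_trans (iterRealisations_one (realisations_singleton (Nat.zero_le m) .a)) hu'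
  rw [add_comm] at this
  exact ⟨u', this, hi⟩

include hm in
theorem exists_infix_of_le {n k : ℕ} (hnk : n ≤ k) {u : Word}
    (hu : u ∈ iterRealisations m n [.a]) : ∃ u' ∈ iterRealisations m k [.a], u <:+: u' := by
  induction k, hnk using Nat.le_induction with
  | base => exact ⟨u, hu, List.infix_rfl⟩
  | succ k _ ih =>
    obtain ⟨v, hv, hi⟩ := ih
    obtain ⟨v', hv', hi'⟩ := exists_infix_succ hm hv
    exact ⟨v', hv', hi.trans hi'⟩

include hm in
-- For `m ≥ 1` the image of `a` contains `a`, so realisations persist as subwords at every later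
-- level. A single level can therefore serve finitely many legal words at once.
theorem Legal.eventually {w : Word} (h : Legal m w) :
    ∃ k, ∀ n ≥ k, ∃ u ∈ iterRealisations m n [.a], w <:+: u := by
  obtain ⟨k, -, u, hu, hi⟩ := h
  refine ⟨k, fun n hn => ?_⟩
  obtain ⟨u', hu', hi'⟩ := exists_infix_of_le hm hn hu
  exact ⟨u', hu', hi.trans hi'⟩

include hm in
-- In `ba` the `b` becomes `a` and the `a` may become `aᵐb`. Legality of `aa` makes the
-- concatenation of two realisations of equal level legal.
theorem exists_aa : ∃ u ∈ iterRealisations m 2 [.a], [Letter.a, .a] <:+: u := by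
  have h1 := iterRealisations_one (realisations_singleton (Nat.zero_le m) .a)
  have h2 : [Letter.b, .a] <:+: nms m 0 .a := ⟨[], List.replicate (m - 1) .a, by
    obtain ⟨k, rfl⟩ : ∃ k, m = k + 1 := ⟨m - 1, by omega⟩
    simp [nms, List.replicate_succ]⟩
  have h3 : nms m 0 .b ++ nms m m .a ∈ iterRealisations m 1 [.b, .a] :=
    iterRealisations_one ⟨0, Nat.zero_le _, nms m m .a, ⟨m, le_rfl, [], rfl, by simp⟩, rfl⟩
  obtain ⟨u, hu, hi⟩ := iterRealisations_infix h2 h3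
  refine ⟨u, iterRealisations_trans h1 hu, List.IsInfix.trans ?_ hi⟩
  refine ⟨[], List.replicate (m - 1) .a ++ [.b], ?_⟩
  obtain ⟨k, rfl⟩ : ∃ k, m = k + 1 := ⟨m - 1, by omega⟩
  simp [nms, List.replicate_succ]

include hm in
theorem legal_append {n : ℕ} {u v : Word} (hu : u ∈ iterRealisations m n [.a])
    (hv : v ∈ iterRealisations m n [.a]) : Legal m (u ++ v) := by
  obtain ⟨x, hx, hi⟩ := exists_aa hm
  have h : u ++ v ∈ iterRealisations m n [.a, .a] :=
    iterRealisations_append (w := [.a]) (w' := [.a]).2 ⟨u, hu, v, hv, rfl⟩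
  obtain ⟨y, hy, hi'⟩ := iterRealisations_infix hi h
  exact ⟨2 + n, by omega, y, iterRealisations_trans hx hy, hi'⟩

include hm in
-- If `w` occurs in a realisation `u`, then in the legal word `uu` its first occurrence is not at
-- the end.
theorem Legal.exists_concat {w : Word} (h : Legal m w) : ∃ c, Legal m (w ++ [c]) := by
  obtain ⟨k, -, u, hu, s, t, rfl⟩ := h
  have h2 := legal_append hm hu hu
  have hne := ne_nil_of_mem_iterRealisations (by simp) hu
  obtain ⟨c, r, hc⟩ : ∃ c r, t ++ (s ++ w ++ t) = c :: r :=
    List.exists_cons_of_ne_nil (by intro h; exact hne (List.append_eq_nil_iff.1 h).2)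
  refine ⟨c, h2.of_infix ⟨s, r, ?_⟩⟩
  rw [List.append_assoc (s ++ w) t, hc]; simp

include hm in
theorem legal_nil : Legal m [] := by
  obtain ⟨u, hu, -⟩ := exists_aa hm
  exact ⟨2, by omega, u, hu, List.nil_infix⟩

include hm in
theorem exists_legal (ℓ : ℕ) : ∃ w : Word, w.length = ℓ ∧ Legal m w := by
  induction ℓ with
  | zero => exact ⟨[], rfl, legal_nil hm⟩
  | succ ℓ ih =>
    obtain ⟨w, hl, hw⟩ := ih
    obtain ⟨c, hc⟩ := hw.exists_concat hm
    exact ⟨w ++ [c], by simp [hl], hc⟩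

/-- A legal word as an element of the index type. -/
def toLegal (w : Word) {ℓ : ℕ} (hl : w.length = ℓ) (hw : Legal m w) : LegalWord m ℓ :=
  ⟨fun i => w[i.1]'(by omega), by
    have : List.ofFn (fun i : Fin ℓ => w[i.1]'(by omega)) = w := by
      subst hl; exact List.ofFn_getElem
    rw [this]; exact hw⟩

@[simp] theorem ofFn_toLegal (w : Word) {ℓ : ℕ} (hl : w.length = ℓ) (hw : Legal m w) :
    List.ofFn (toLegal w hl hw).1 = w := by
  subst hl; exact List.ofFn_getElem

theorem LegalWord.ofFn_injective {ℓ : ℕ} :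
    Function.Injective (fun v : LegalWord m ℓ => List.ofFn v.1) :=
  fun _ _ h => Subtype.ext (List.ofFn_injective h)

include hm in
theorem nonempty_legalWord (ℓ : ℕ) : Nonempty (LegalWord m ℓ) := by
  obtain ⟨w, hl, hw⟩ := exists_legal hm ℓ
  exact ⟨toLegal w hl hw⟩

/-- A sum over legal words of length `ℓ` that is concentrated at one word. -/
theorem sum_legalWord_ite {ℓ : ℕ} {w : Word} (hl : w.length = ℓ) (hw : Legal m w)
    (F : Word → ℝ) :
    ∑ v : LegalWord m ℓ, (if w = List.ofFn v.1 then F (List.ofFn v.1) else 0) = F w := by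
  classical
  rw [Finset.sum_eq_single (toLegal w hl hw)]
  · simp
  · intro v _ hv
    rw [if_neg]
    intro h
    apply hv
    apply LegalWord.ofFn_injective
    simp [h]
  · simp

/-! ### The induced substitution as an operator on functions of words -/

/-- The subword of `u` of length `ℓ` at position `k`. -/
def window (ℓ k : ℕ) (u : Word) : Word := (u.drop k).take ℓ

theorem window_infix (ℓ k : ℕ) (u : Word) : window ℓ k u <:+: u :=
  (List.take_prefix _ _).isInfix.trans (List.drop_suffix _ _).isInfix

theorem length_window {ℓ k : ℕ} {u : Word} (h : k + ℓ ≤ u.length) : (window ℓ k u).length = ℓ := by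
  simp [window]; omega

theorem window_append {ℓ k : ℕ} {u : Word} (h : k + ℓ ≤ u.length) (u' : Word) :
    window ℓ k (u ++ u') = window ℓ k u := by
  unfold window
  rw [List.drop_append_of_le_length (by omega), List.take_append_of_le_length (by simp; omega)]

theorem window_append_right (ℓ k : ℕ) (u u' : Word) :
    window ℓ (u.length + k) (u ++ u') = window ℓ k u' := by
  have h : u.drop (u.length + k) = [] := List.drop_eq_nil_of_le (by omega)
  simp [window, List.drop_append, h]

/-- The transposed action of the induced substitution on a function `G` of words of length `ℓ`:
the expected sum of `G` over the subwords that start in the image of the first letter. -/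
def inducedMap (p : Fin (m + 1) → ℝ) (ℓ : ℕ) (G : Word → ℝ) : Word → ℝ
  | [] => 0
  | c :: w => expectImage p (c :: w) fun u =>
      ∑ k ∈ Finset.range (imageLength m c), G (window ℓ k u)

variable (p : Fin (m + 1) → ℝ)

/-- No letter has an empty image, so the letters after the first supply at least `ℓ - 1` further
positions. This suffices even when the window starts at the last position of the first image. -/
theorem window_fits {ℓ k : ℕ} {c : Letter} {w u : Word} (hu : u ∈ realisations m (c :: w))
    (hk : k < imageLength m c) (hℓ : ℓ ≤ w.length + 1) : k + ℓ ≤ u.length := by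
  have h1 := length_of_mem_realisations hu
  have h2 := length_le_imageLen m w
  simp at h1
  omega

/-- The relevant windows already fit into the image of `w`; the remaining letters are averaged out.
-/
theorem inducedMap_append {ℓ : ℕ} {w : Word} (hℓ1 : 1 ≤ ℓ) (hw : ℓ ≤ w.length) (w' : Word)
    (hsum : ∑ i, p i = 1) (G : Word → ℝ) :
    inducedMap p ℓ G (w ++ w') = inducedMap p ℓ G w := by
  cases w with
  | nil => simp at hw; omega
  | cons c w =>
    simp only [List.cons_append, inducedMap]
    rw [← List.cons_append, expectImage_append]
    refine expectImage_congr p fun u hu => ?_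
    have : ∀ u', ∑ k ∈ Finset.range (imageLength m c), G (window ℓ k (u ++ u')) =
        ∑ k ∈ Finset.range (imageLength m c), G (window ℓ k u) := fun u' =>
      Finset.sum_congr rfl fun k hk => by
        rw [window_append (window_fits hu (Finset.mem_range.1 hk) (by simpa using hw))]
    simp only [this]
    exact expectImage_const hsum _ _

/-- Identifies the transposed matrix with an operator on functions of words. Windows in images of
legal words are legal, so no term is lost by summing over legal `v` only. -/
theorem sum_mul_inducedMatrix {ℓ : ℕ} (F : Word → ℝ) (w : LegalWord m ℓ) :
    ∑ v, F (List.ofFn v.1) * inducedMatrix p ℓ v w = inducedMap p ℓ F (List.ofFn w.1) := by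
  unfold inducedMatrix
  simp only [← expectImage_const_mul]
  rw [← expectImage_sum]
  rcases hw : List.ofFn w.1 with _ | ⟨c, t⟩
  · simp [inducedMap, expectImage, inducedCount]
  · refine expectImage_congr p fun u hu => ?_
    have hlen : t.length + 1 = ℓ := by
      have := congrArg List.length hw; simp at this; omega
    have hleg : Legal m u := Legal.image (by rw [← hw]; exact w.2) hu
    simp only [inducedCount, List.length_ofFn, Finset.card_filter, Nat.cast_sum, Nat.cast_ite,
      Nat.cast_one, Nat.cast_zero, Finset.mul_sum, mul_ite, mul_one, mul_zero]
    rw [Finset.sum_comm]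
    refine Finset.sum_congr rfl fun k hk => ?_
    have := sum_legalWord_ite (m := m) (w := window ℓ k u) (ℓ := ℓ)
      (length_window (window_fits hu (Finset.mem_range.1 hk) (by omega)))
      (hleg.of_infix (window_infix _ _ _)) F
    exact this

/-- The expectation of a function of words of length `ℓ` with respect to the weights `φ`. -/
def wordMean {ℓ : ℕ} (φ : LegalWord m ℓ → ℝ) (F : Word → ℝ) : ℝ :=
  ∑ w, φ w * F (List.ofFn w.1)

variable {p}

/-- The eigenvector equation in dual form, which is how it enters the consistency and
renormalisation arguments. -/
theorem IsPFVector.wordMean_inducedMap {ℓ : ℕ} {φ : LegalWord m ℓ → ℝ} (hφ : IsPFVector p ℓ φ)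
    (F : Word → ℝ) : wordMean φ (inducedMap p ℓ F) = inflation m * wordMean φ F := by
  unfold wordMean
  simp only [← sum_mul_inducedMatrix, Finset.mul_sum]
  rw [Finset.sum_comm]
  refine Finset.sum_congr rfl fun v _ => ?_
  have h := congrFun hφ.eigen v
  simp only [Matrix.mulVec, dotProduct, Pi.smul_apply, smul_eq_mul] at h
  rw [← mul_assoc, ← h, Finset.sum_mul]
  exact Finset.sum_congr rfl fun w _ => by ring

end

section

/-! ### Primitivity of the induced matrices and the Perron–Frobenius vectors -/

theorem inflation_sq (m : ℕ) : inflation m * inflation m = m * inflation m + 1 := by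
  unfold inflation
  have := Real.mul_self_sqrt (show (0 : ℝ) ≤ (m : ℝ) ^ 2 + 4 by positivity)
  nlinarith

theorem inflation_gt_one {m : ℕ} (hm : 1 ≤ m) : 1 < inflation m := by
  unfold inflation
  have h1 : (1 : ℝ) ≤ m := by exact_mod_cast hm
  have : (1 : ℝ) < Real.sqrt ((m : ℝ) ^ 2 + 4) := by
    apply Real.lt_sqrt_of_sq_lt; nlinarith
  linarith

/-- The left eigenvector of the substitution matrix. -/
def letterVec (m : ℕ) : Letter → ℝ
  | .a => inflation m
  | .b => 1

theorem letterVec_pos (m : ℕ) (hm : 1 ≤ m) (c : Letter) : 0 < letterVec m c := by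
  have := inflation_gt_one hm
  cases c <;> simp only [letterVec] <;> linarith

theorem pullWeight_letterVec (m : ℕ) (c : Letter) :
    pullWeight m (letterVec m) c = inflation m * letterVec m c := by
  cases c
  · simp only [pullWeight, letterVec, inflation_sq]
  · simp [pullWeight, letterVec]

/-- The weight of the first letter of a word. -/
def headWeight (c : Letter → ℝ) : Word → ℝ
  | [] => 0
  | x :: _ => c x

theorem window_succ_cons (ℓ k : ℕ) (x : Letter) (u : Word) :
    window ℓ (k + 1) (x :: u) = window ℓ k u := by simp [window]

theorem sum_headWeight_window {ℓ : ℕ} (hℓ : 1 ≤ ℓ) (c : Letter → ℝ) (x y : Word) :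
    ∑ k ∈ Finset.range x.length, headWeight c (window ℓ k (x ++ y)) = weight c x := by
  induction x with
  | nil => simp
  | cons d x ih =>
    rw [List.length_cons, Finset.sum_range_succ']
    simp only [List.cons_append, window_succ_cons, ih]
    obtain ⟨l, rfl⟩ : ∃ l, ℓ = l + 1 := ⟨ℓ - 1, by omega⟩
    simp [window, headWeight, add_comm]

/-- Reading the head letter of each window that starts in the image of the first letter spells out
that image, whose weight is not random. With `letterVec` this produces the left eigenvector of the
induced matrix. -/
theorem inducedMap_headWeight {m : ℕ} {p : Fin (m + 1) → ℝ} (hsum : ∑ i, p i = 1) {ℓ : ℕ}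
    (hℓ : 1 ≤ ℓ) (c : Letter → ℝ) (w : Word) :
    inducedMap p ℓ (headWeight c) w = headWeight (pullWeight m c) w := by
  cases w with
  | nil => rfl
  | cons x w =>
    rw [show headWeight (pullWeight m c) (x :: w) = pullWeight m c x from rfl, inducedMap,
      ← expectImage_const hsum (x :: w) (pullWeight m c x)]
    refine expectImage_congr p fun u hu => ?_
    obtain ⟨i, hi, v, hv, rfl⟩ := hu
    rw [← length_nms hi, sum_headWeight_window hℓ, weight_nms hi]

theorem realisations_split {m : ℕ} {w u : Word} (hu : u ∈ realisations m w) {k : ℕ}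
    (hk : k < u.length) : ∃ x d y X Y r, w = x ++ d :: y ∧ u = X ++ Y ∧ X ∈ realisations m x ∧
      Y ∈ realisations m (d :: y) ∧ r < imageLength m d ∧ k = X.length + r := by
  induction w generalizing u k with
  | nil => simp only [realisations, Set.mem_singleton_iff] at hu; subst hu; simp at hk
  | cons c w ih =>
    by_cases h : k < imageLength m c
    · exact ⟨[], c, w, [], u, k, rfl, rfl, rfl, hu, h, by simp⟩
    · obtain ⟨i, hi, v, hv, rfl⟩ := hu
      rw [List.length_append, length_nms hi] at hk
      obtain ⟨x, d, y, X, Y, r, rfl, rfl, hX, hY, hr, hk'⟩ :=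
        ih hv (k := k - imageLength m c) (by omega)
      refine ⟨c :: x, d, y, nms m i c ++ X, Y, r, by simp, by simp, ⟨i, hi, X, hX, rfl⟩, hY, hr, ?_⟩
      rw [List.length_append, length_nms hi]; omega

section Primitive

variable {m : ℕ} {p : Fin (m + 1) → ℝ} (hm : 1 ≤ m) (hp : ∀ i, 0 < p i) (hsum : ∑ i, p i = 1)

include hp hsum in
theorem inducedMatrix_nonneg (ℓ : ℕ) (v w : LegalWord m ℓ) : 0 ≤ inducedMatrix p ℓ v w :=
  expectImage_nonneg hp hsum fun _ _ => Nat.cast_nonneg _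

include hp hsum in
theorem inducedMatrix_pos {ℓ : ℕ} {v w : LegalWord m ℓ} {c : Letter} {t u : Word}
    (hw : List.ofFn w.1 = c :: t) (hu : u ∈ realisations m (c :: t)) {k : ℕ}
    (hk : k < imageLength m c) (hv : window ℓ k u = List.ofFn v.1) :
    0 < inducedMatrix p ℓ v w := by
  unfold inducedMatrix
  refine expectImage_pos hp hsum (fun _ _ => Nat.cast_nonneg _) (by rw [hw]; exact hu) ?_
  rw [hw, Nat.cast_pos]
  refine Finset.card_pos.2 ⟨k, Finset.mem_filter.2 ⟨Finset.mem_range.2 hk, ?_⟩⟩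
  rw [List.length_ofFn]; exact hv

theorem length_le_of_mem_iterRealisations {n : ℕ} {w u : Word} (hu : u ∈ iterRealisations m n w) :
    w.length ≤ u.length := by
  induction n generalizing u with
  | zero => simp only [iterRealisations, Set.mem_singleton_iff] at hu; subst hu; rfl
  | succ n ih =>
    obtain ⟨v, hv, hu⟩ := hu
    have h1 := length_of_mem_realisations hu
    have h2 := length_le_imageLen m v
    have := ih hv
    omega

theorem Legal.iterImage {n : ℕ} {w u : Word} (h : Legal m w) (hu : u ∈ iterRealisations m n w) :
    Legal m u := by
  induction n generalizing u with
  | zero => simp only [iterRealisations, Set.mem_singleton_iff] at hu; subst hu; exact h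
  | succ n ih => obtain ⟨v, hv, hu⟩ := hu; exact (ih hv).image hu

include hp hsum in
-- Trace the window `v` back one level: the letter `d` whose image covers position `k` starts a
-- legal window `q`. By induction `q` is reachable from `w`, and one more step leads from `q` to
-- `v`.
theorem inducedMatrix_pow_pos {ℓ : ℕ} {w : LegalWord m ℓ} {c : Letter} {t : Word}
    (hw : List.ofFn w.1 = c :: t) {n : ℕ} {v : LegalWord m ℓ} {U U' : Word}
    (hU : U ∈ iterRealisations m n [c]) (hU' : U' ∈ iterRealisations m n t) {k : ℕ}
    (hk : k < U.length) (hv : window ℓ k (U ++ U') = List.ofFn v.1) :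
    0 < (inducedMatrix p ℓ ^ n) v w := by
  have htlen : t.length + 1 = ℓ := by
    have := congrArg List.length hw; simp at this; omega
  induction n generalizing v U U' k with
  | zero =>
    simp only [iterRealisations, Set.mem_singleton_iff] at hU hU'
    subst hU hU'
    simp only [List.length_singleton, Nat.lt_one_iff] at hk
    subst hk
    have : v = w := by
      apply LegalWord.ofFn_injective
      simp only
      rw [← hv, hw]
      simp [window, ← htlen]
    subst this
    simp
  | succ n ih =>
    obtain ⟨V, hV, hU⟩ := hU
    obtain ⟨V', hV', hU'⟩ := hU'
    obtain ⟨x, d, y, X, Y, r, rfl, rfl, hX, hY, hr, rfl⟩ := realisations_split hU hk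
    have hlenV' := length_le_of_mem_iterRealisations hV'
    have hlegV : Legal m ((x ++ d :: y) ++ V') := by
      refine Legal.iterImage w.2 (n := n) ?_
      rw [hw]
      exact iterRealisations_append (w := [c]).2 ⟨_, hV, _, hV', rfl⟩
    set q : Word := window ℓ x.length ((x ++ d :: y) ++ V') with hq
    have hqlen : q.length = ℓ := length_window (by simp; omega)
    have hqleg : Legal m q := hlegV.of_infix (window_infix _ _ _)
    have hqd : q = d :: (y ++ V').take (ℓ - 1) := by
      obtain ⟨l, rfl⟩ : ∃ l, ℓ = l + 1 := ⟨ℓ - 1, by omega⟩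
      simp [hq, window]
    have h1 := ih (v := toLegal q hqlen hqleg) hV hV' (k := x.length) (by simp) (by simp [hq])
    have hYU : Y ++ U' ∈ realisations m (q ++ (y ++ V').drop (ℓ - 1)) := by
      have : q ++ (y ++ V').drop (ℓ - 1) = (d :: y) ++ V' := by rw [hqd]; simp
      rw [this]
      exact realisations_append.2 ⟨Y, hY, U', hU', rfl⟩
    -- The image of `q` alone already contains the window; the image of the letters beyond `q` is
    -- discarded.
    obtain ⟨Y₁, hY₁, Y₂, -, hYY⟩ := realisations_append.1 hYU
    have h2 : 0 < inducedMatrix p ℓ v (toLegal q hqlen hqleg) := by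
      rw [hqd] at hY₁
      refine inducedMatrix_pos hp hsum (by rw [ofFn_toLegal, hqd]) hY₁ hr ?_
      rw [← hv, List.append_assoc, window_append_right, hYY, window_append]
      refine window_fits hY₁ hr ?_
      have := congrArg List.length hqd
      simp only [List.length_cons] at this
      omega
    rw [pow_succ', Matrix.mul_apply]
    exact Finset.sum_pos' (fun j _ => mul_nonneg (inducedMatrix_nonneg hp hsum _ _ _)
      (pow_nonneg_entries (inducedMatrix_nonneg hp hsum ℓ) _ _ _))
      ⟨_, Finset.mem_univ _, mul_pos h2 h1⟩

include hm hp hsum in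
theorem inducedMatrix_primitive {ℓ : ℕ} (hℓ : 1 ≤ ℓ) :
    ∃ k, ∀ v w, 0 < (inducedMatrix p ℓ ^ k) v w := by
  have h : ∀ v : LegalWord m ℓ, ∃ k, ∀ n ≥ k, ∃ u ∈ iterRealisations m n [.a],
      List.ofFn v.1 <:+: u := fun v => v.2.eventually hm
  choose K hK using h
  -- An exponent beyond all levels `K v`; the extra step lets an initial `b` become `a` first.
  refine ⟨(∑ v, K v) + 1, fun v w => ?_⟩
  have hKv : K v ≤ ∑ v, K v := Finset.single_le_sum (fun _ _ => Nat.zero_le _) (Finset.mem_univ v)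
  obtain ⟨c, t, hw⟩ : ∃ c t, List.ofFn w.1 = c :: t :=
    List.exists_cons_of_ne_nil (by rw [Ne, ← List.length_eq_zero_iff]; simp; omega)
  obtain ⟨U, hU, s, s', hs⟩ : ∃ U ∈ iterRealisations m ((∑ v, K v) + 1) [c],
      List.ofFn v.1 <:+: U := by
    cases c
    · exact hK v _ (by omega)
    · obtain ⟨u, hu, hi⟩ := hK v (∑ v, K v) hKv
      refine ⟨u, ?_, hi⟩
      have h0 : [Letter.a] ∈ iterRealisations m 1 [.b] :=
        iterRealisations_one (realisations_singleton (Nat.zero_le m) .b)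
      have := iterRealisations_trans h0 hu
      rwa [add_comm] at this
  obtain ⟨U', hU'⟩ := iterRealisations_nonempty m ((∑ v, K v) + 1) t
  refine inducedMatrix_pow_pos hp hsum hw hU hU' (k := s.length) ?_ ?_
  · rw [← hs]; simp; omega
  · rw [← hs]; simp [window]

/-- Existence of the Perron–Frobenius vector, together with the convergence to the Perron
projection of the powers of the transposed induced matrix. -/
theorem exists_isPFVector_tendsto (hm : 1 ≤ m) (hp : ∀ i, 0 < p i) (hsum : ∑ i, p i = 1) {ℓ : ℕ}
    (hℓ : 1 ≤ ℓ) : ∃ φ : LegalWord m ℓ → ℝ, IsPFVector p ℓ φ ∧ ∃ C : ℝ, 0 < C ∧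
      ∀ (f : LegalWord m ℓ → ℝ) (w : LegalWord m ℓ),
        Tendsto (fun n : ℕ => (∑ v, f v * (inducedMatrix p ℓ ^ n) v w) / inflation m ^ n) atTop
          (𝓝 ((∑ v, φ v * f v) * headWeight (letterVec m) (List.ofFn w.1) / C)) := by
  have := nonempty_legalWord hm ℓ
  obtain ⟨k, hk⟩ := inducedMatrix_primitive hm hp hsum hℓ
  have hH : ∀ v : LegalWord m ℓ, 0 < headWeight (letterVec m) (List.ofFn v.1) := fun v => by
    obtain ⟨c, t, hw⟩ : ∃ c t, List.ofFn v.1 = c :: t :=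
      List.exists_cons_of_ne_nil (by rw [Ne, ← List.length_eq_zero_iff]; simp; omega)
    rw [hw]; exact letterVec_pos m hm c
  obtain ⟨φ, h1, h2, h3, h4⟩ := exists_perron
    (H := fun v : LegalWord m ℓ => headWeight (letterVec m) (List.ofFn v.1))
    (lt_trans one_pos (inflation_gt_one hm)) (inducedMatrix_nonneg hp hsum ℓ) hH (fun w => by
      rw [sum_mul_inducedMatrix, inducedMap_headWeight hsum hℓ]
      obtain ⟨c, t, hw⟩ : ∃ c t, List.ofFn w.1 = c :: t :=
        List.exists_cons_of_ne_nil (by rw [Ne, ← List.length_eq_zero_iff]; simp; omega)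
      rw [hw]; exact pullWeight_letterVec m c) hk
  exact ⟨φ, ⟨h1, h2, h3⟩, _,
    Finset.sum_pos (fun v _ => mul_pos (h1 v) (hH v)) Finset.univ_nonempty, h4⟩

theorem pow_mulVec_eigen {ι : Type*} [Fintype ι] [DecidableEq ι] {M : Matrix ι ι ℝ} {r : ℝ}
    {x : ι → ℝ} (h : M.mulVec x = r • x) (n : ℕ) : (M ^ n).mulVec x = r ^ n • x := by
  induction n with
  | zero => simp
  | succ n ih => rw [pow_succ, ← Matrix.mulVec_mulVec, h, Matrix.mulVec_smul, ih, smul_smul,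
      pow_succ']

/-- A normalised eigenvector of the induced matrix for the inflation multiplier is the
Perron–Frobenius vector. -/
theorem existsUnique_eigenvector (hm : 1 ≤ m) (hp : ∀ i, 0 < p i) (hsum : ∑ i, p i = 1) {ℓ : ℕ}
    (hℓ : 1 ≤ ℓ) : ∃ φ : LegalWord m ℓ → ℝ, IsPFVector p ℓ φ ∧ ∀ ψ : LegalWord m ℓ → ℝ,
      ∑ v, ψ v = 1 → (inducedMatrix p ℓ).mulVec ψ = inflation m • ψ → ψ = φ := by
  obtain ⟨φ, hφ, C, hC, hlim⟩ := exists_isPFVector_tendsto hm hp hsum hℓ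
  refine ⟨φ, hφ, fun ψ hψ1 hψ => ?_⟩
  have hlam : (0 : ℝ) < inflation m := lt_trans one_pos (inflation_gt_one hm)
  -- `Mⁿ / λⁿ` fixes `ψ` and converges to the projection onto the line of `φ`, so `ψ = B φ`; the
  -- normalisation forces `B = 1`. Positivity of `ψ` plays no role.
  set B : ℝ := ∑ w, headWeight (letterVec m) (List.ofFn w.1) / C * ψ w with hB
  have key : ∀ v, ψ v = φ v * B := by
    intro v
    have h1 : Tendsto (fun n : ℕ => ∑ w, (∑ v', (Pi.single v (1 : ℝ) : _ → ℝ) v' *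
        (inducedMatrix p ℓ ^ n) v' w) / inflation m ^ n * ψ w) atTop
        (𝓝 (∑ w, (∑ v', φ v' * (Pi.single v (1 : ℝ) : _ → ℝ) v') *
          headWeight (letterVec m) (List.ofFn w.1) / C * ψ w)) :=
      tendsto_finsetSum _ fun w _ => (hlim _ w).mul_const _
    have h2 : ∀ n : ℕ, ∑ w, (∑ v', (Pi.single v (1 : ℝ) : _ → ℝ) v' *
        (inducedMatrix p ℓ ^ n) v' w) / inflation m ^ n * ψ w = ψ v := by
      intro n
      have h3 := congrFun (pow_mulVec_eigen hψ n) v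
      simp only [Matrix.mulVec, dotProduct, Pi.smul_apply, smul_eq_mul] at h3
      have h4 := (pow_pos hlam n).ne'
      have h5 : ψ v = (∑ w, (inducedMatrix p ℓ ^ n) v w * ψ w) / inflation m ^ n := by
        rw [h3]; field_simp
      rw [h5, Finset.sum_div]
      refine Finset.sum_congr rfl fun w _ => ?_
      have : ∑ v', (Pi.single v (1 : ℝ) : _ → ℝ) v' * (inducedMatrix p ℓ ^ n) v' w =
          (inducedMatrix p ℓ ^ n) v w := by simp [Pi.single_apply]
      rw [this]; ring
    simp only [h2] at h1
    have h3 := tendsto_nhds_unique tendsto_const_nhds h1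
    rw [h3, hB, Finset.mul_sum]
    refine Finset.sum_congr rfl fun w _ => ?_
    have : ∑ v', φ v' * (Pi.single v (1 : ℝ) : _ → ℝ) v' = φ v := by simp [Pi.single_apply]
    rw [this]; ring
  have hB1 : B = 1 := by
    have : ∑ v, ψ v = ∑ v, φ v * B := Finset.sum_congr rfl fun v _ => key v
    rw [hψ1, ← Finset.sum_mul, hφ.sum_eq_one, one_mul] at this
    exact this.symm
  ext v
  rw [key v, hB1, mul_one]

theorem existsUnique_isPFVector (hm : 1 ≤ m) (hp : ∀ i, 0 < p i) (hsum : ∑ i, p i = 1) {ℓ : ℕ}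
    (hℓ : 1 ≤ ℓ) : ∃! φ : LegalWord m ℓ → ℝ, IsPFVector p ℓ φ := by
  obtain ⟨φ, hφ, h⟩ := existsUnique_eigenvector hm hp hsum hℓ
  exact ⟨φ, hφ, fun ψ hψ => h ψ hψ.sum_eq_one hψ.eigen⟩

end Primitive

end

section

/-! ### Consistency of the Perron–Frobenius vectors -/

section WordMean

variable {m ℓ : ℕ} (φ : LegalWord m ℓ → ℝ)

theorem wordMean_congr {F G : Word → ℝ} (h : ∀ w, w.length = ℓ → Legal m w → F w = G w) :
    wordMean φ F = wordMean φ G :=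
  Finset.sum_congr rfl fun w _ => by rw [h _ (by simp) w.2]

theorem wordMean_add (F G : Word → ℝ) :
    wordMean φ (fun w => F w + G w) = wordMean φ F + wordMean φ G := by
  simp [wordMean, mul_add, Finset.sum_add_distrib]

theorem wordMean_sub (F G : Word → ℝ) :
    wordMean φ (fun w => F w - G w) = wordMean φ F - wordMean φ G := by
  simp [wordMean, mul_sub, Finset.sum_sub_distrib]

theorem wordMean_const_mul (r : ℝ) (F : Word → ℝ) :
    wordMean φ (fun w => r * F w) = r * wordMean φ F := by
  simp only [wordMean, Finset.mul_sum]
  exact Finset.sum_congr rfl fun w _ => by ring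

theorem wordMean_sum {ι : Type*} (s : Finset ι) (F : ι → Word → ℝ) :
    wordMean φ (fun w => ∑ i ∈ s, F i w) = ∑ i ∈ s, wordMean φ (F i) := by
  simp only [wordMean, Finset.mul_sum]
  exact Finset.sum_comm

/-- The indicator function of a word. -/
def wordInd (v w : Word) : ℝ := if w = v then 1 else 0

theorem wordMean_wordInd (v : LegalWord m ℓ) : wordMean φ (wordInd (List.ofFn v.1)) = φ v := by
  classical
  unfold wordMean wordInd
  rw [Finset.sum_eq_single v]
  · simp
  · intro w _ hw
    rw [if_neg fun h => hw (LegalWord.ofFn_injective h), mul_zero]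
  · simp

variable {φ}

theorem wordMean_mono (hφ : ∀ v, 0 ≤ φ v) {F G : Word → ℝ}
    (h : ∀ w, w.length = ℓ → Legal m w → F w ≤ G w) : wordMean φ F ≤ wordMean φ G :=
  Finset.sum_le_sum fun w _ => mul_le_mul_of_nonneg_left (h _ (by simp) w.2) (hφ w)

theorem wordMean_const (h : ∑ v, φ v = 1) (r : ℝ) : wordMean φ (fun _ => r) = r := by
  simp [wordMean, ← Finset.sum_mul, h]

theorem wordMean_pushforward {L : ℕ} (φ : LegalWord m L → ℝ) (τ : Word → Word)
    (hτ : ∀ w, w.length = L → Legal m w → (τ w).length = ℓ ∧ Legal m (τ w)) (F : Word → ℝ) :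
    wordMean (fun v : LegalWord m ℓ => wordMean φ fun w => wordInd (List.ofFn v.1) (τ w)) F =
      wordMean φ fun w => F (τ w) := by
  have h : ∀ w, w.length = L → Legal m w → F (τ w) =
      ∑ v : LegalWord m ℓ, wordInd (List.ofFn v.1) (τ w) * F (List.ofFn v.1) := by
    intro w hl hw
    rw [← sum_legalWord_ite (hτ w hl hw).1 (hτ w hl hw).2 F]
    exact Finset.sum_congr rfl fun v _ => by simp [wordInd]
  rw [wordMean_congr φ h, wordMean_sum]
  refine Finset.sum_congr rfl fun v _ => ?_
  simp only [mul_comm _ (F _), wordMean_const_mul]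

end WordMean

variable {m : ℕ} {p : Fin (m + 1) → ℝ} (hm : 1 ≤ m) (hp : ∀ i, 0 < p i) (hsum : ∑ i, p i = 1)

theorem inducedMatrix_eq {ℓ : ℕ} (v w : LegalWord m ℓ) :
    inducedMatrix p ℓ v w = inducedMap p ℓ (wordInd (List.ofFn v.1)) (List.ofFn w.1) := by
  classical
  rw [← sum_mul_inducedMatrix, Finset.sum_eq_single v]
  · simp [wordInd]
  · intro w' _ h
    rw [wordInd, if_neg fun h' => h (LegalWord.ofFn_injective h'), zero_mul]
  · simp

theorem mulVec_inducedMatrix {ℓ : ℕ} (ψ : LegalWord m ℓ → ℝ) (v : LegalWord m ℓ) :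
    (inducedMatrix p ℓ).mulVec ψ v = wordMean ψ (inducedMap p ℓ (wordInd (List.ofFn v.1))) := by
  simp only [Matrix.mulVec, dotProduct, wordMean, inducedMatrix_eq]
  exact Finset.sum_congr rfl fun w _ => mul_comm _ _

theorem legal_take {w : Word} (hw : Legal m w) (k : ℕ) : Legal m (w.take k) :=
  hw.of_infix (List.take_prefix _ _).isInfix

theorem legal_tail {w : Word} (hw : Legal m w) : Legal m w.tail :=
  hw.of_infix (List.tail_suffix _).isInfix

include hm hp hsum in
-- The induced map of length `ℓ` depends only on the first `ℓ` letters, so the marginal `ψ` of `φ'`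
-- is again a normalised eigenvector for `λ`. Uniqueness among all such eigenvectors gives the
-- claim.
theorem wordMean_take {ℓ : ℕ} (hℓ : 1 ≤ ℓ) {φ : LegalWord m ℓ → ℝ}
    {φ' : LegalWord m (ℓ + 1) → ℝ} (hφ : IsPFVector p ℓ φ) (hφ' : IsPFVector p (ℓ + 1) φ')
    (F : Word → ℝ) : wordMean φ' (fun w => F (w.take ℓ)) = wordMean φ F := by
  have hτ : ∀ w, w.length = ℓ + 1 → Legal m w → (w.take ℓ).length = ℓ ∧ Legal m (w.take ℓ) :=
    fun w hl hw => ⟨by simp; omega, legal_take hw _⟩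
  set ψ : LegalWord m ℓ → ℝ :=
    fun v => wordMean φ' fun w => wordInd (List.ofFn v.1) (w.take ℓ) with hψ
  have hpush : ∀ G : Word → ℝ, wordMean ψ G = wordMean φ' fun w => G (w.take ℓ) :=
    fun G => wordMean_pushforward φ' (fun w => w.take ℓ) hτ G
  have h1 : ∑ v, ψ v = 1 := by
    have := hpush fun _ => 1
    rw [wordMean_const hφ'.sum_eq_one] at this
    simpa [wordMean] using this
  have h2 : (inducedMatrix p ℓ).mulVec ψ = inflation m • ψ := by
    ext v
    rw [mulVec_inducedMatrix, hpush]
    have := hφ'.wordMean_inducedMap fun w => wordInd (List.ofFn v.1) (w.take ℓ)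
    simp only [Pi.smul_apply, smul_eq_mul, hψ]
    rw [← this]
    refine wordMean_congr _ fun w hl hw => ?_
    conv_rhs => rw [← List.take_append_drop ℓ w]
    rw [← inducedMap_append p hℓ (w := w.take ℓ) (by simp; omega) (w.drop ℓ) hsum]
    simp only [List.take_append_drop]
    cases w with
    | nil => rfl
    | cons c t =>
      refine expectImage_congr p fun u _ => Finset.sum_congr rfl fun k _ => ?_
      simp [window, List.take_take]
  obtain ⟨φ₀, -, huniq⟩ := existsUnique_eigenvector hm hp hsum hℓ
  rw [huniq φ hφ.sum_eq_one hφ.eigen, ← huniq ψ h1 h2, hpush]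

include hm hp hsum in
-- The marginal on the last `ℓ` letters is compared with the one on the first `ℓ`. Their difference
-- `D` satisfies `λ · D G = D G'`, where `G'` averages `G` over images and obeys the same sup bound.
-- As `λ > 1`, iteration forces `D = 0`.
theorem wordMean_tail {ℓ : ℕ} (hℓ : 1 ≤ ℓ) {φ : LegalWord m ℓ → ℝ}
    {φ' : LegalWord m (ℓ + 1) → ℝ} (hφ : IsPFVector p ℓ φ) (hφ' : IsPFVector p (ℓ + 1) φ')
    (F : Word → ℝ) : wordMean φ' (fun w => F w.tail) = wordMean φ F := by
  have hlam := inflation_gt_one hm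
  have hlam0 : 0 < inflation m := by linarith
  set D : (Word → ℝ) → ℝ := fun G =>
    wordMean φ' (fun w => G w.tail) - wordMean φ' (fun w => G (w.take ℓ)) with hD
  have hstep : ∀ G : Word → ℝ, inflation m * D G =
      D fun w => expectImage p w fun u => G (u.take ℓ) := by
    intro G
    simp only [hD, mul_sub]
    rw [← hφ'.wordMean_inducedMap, ← hφ'.wordMean_inducedMap, ← wordMean_sub, ← wordMean_sub]
    refine wordMean_congr _ fun w hl hw => ?_
    cases w with
    | nil => simp at hl
    | cons c t =>
      have hl' : ℓ ≤ t.length := by simp at hl; omega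
      simp only [inducedMap, List.tail_cons]
      rw [← expectImage_sub]
      -- Telescoping over the positions in the image of `c` leaves the word at the start of the
      -- image of the tail minus the word at the start of the whole image.
      have h1 : ∀ u, ∑ k ∈ Finset.range (imageLength m c), G (window (ℓ + 1) k u).tail -
          ∑ k ∈ Finset.range (imageLength m c), G ((window (ℓ + 1) k u).take ℓ) =
          G (window ℓ (imageLength m c) u) - G (window ℓ 0 u) := by
        intro u
        rw [← Finset.sum_sub_distrib, ← Finset.sum_range_sub fun k => G (window ℓ k u)]
        refine Finset.sum_congr rfl fun k _ => ?_
        have h2 : (window (ℓ + 1) k u).tail = window ℓ (k + 1) u := by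
          rw [window, window, ← List.drop_one, List.drop_take, List.drop_drop, Nat.add_sub_cancel]
        have h3 : (window (ℓ + 1) k u).take ℓ = window ℓ k u := by
          simp [window, List.take_take]
        rw [h2, h3]
      simp only [h1]
      rw [expectImage_sub]
      congr 1
      · rw [← List.singleton_append, expectImage_append]
        rw [← expectImage_const hsum [c] (expectImage p t fun u => G (u.take ℓ))]
        refine expectImage_congr p fun u hu => ?_
        have : imageLength m c = u.length := by
          have := length_of_mem_realisations hu; simpa using this.symm
        rw [this]
        refine congrArg _ (funext fun u' => ?_)
        have := window_append_right ℓ 0 u u'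
        rw [add_zero] at this
        rw [this]; simp [window]
      · conv_lhs => rw [← List.take_append_drop ℓ (c :: t), expectImage_append]
        refine expectImage_congr p fun u hu => ?_
        rw [← expectImage_const hsum ((c :: t).drop ℓ) (G (u.take ℓ))]
        refine congrArg _ (funext fun u' => ?_)
        rw [window_append]
        · simp [window]
        · have h2 := length_of_mem_realisations hu
          have h3 := length_le_imageLen m ((c :: t).take ℓ)
          simp at h3 hl
          omega
  have hbound : ∀ (n : ℕ) (G : Word → ℝ), (∀ w, |G w| ≤ 1) → |D G| ≤ 2 / inflation m ^ n := by
    intro n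
    induction n with
    | zero =>
      intro G hG
      have hle : ∀ τ : Word → Word, |wordMean φ' fun w => G (τ w)| ≤ 1 := fun τ => by
        rw [abs_le]
        constructor
        · rw [← wordMean_const hφ'.sum_eq_one (-1)]
          exact wordMean_mono (fun v => (hφ'.pos v).le) fun w _ _ => (abs_le.1 (hG _)).1
        · conv_rhs => rw [← wordMean_const hφ'.sum_eq_one 1]
          exact wordMean_mono (fun v => (hφ'.pos v).le) fun w _ _ => (abs_le.1 (hG _)).2
      have h1 := hle List.tail
      have h2 := hle (List.take ℓ)
      have := abs_sub (wordMean φ' fun w => G w.tail) (wordMean φ' fun w => G (w.take ℓ))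
      simp only [hD, pow_zero, div_one]
      linarith
    | succ n ih =>
      intro G hG
      have h1 : |D fun w => expectImage p w fun u => G (u.take ℓ)| ≤ 2 / inflation m ^ n := by
        refine ih (fun w => expectImage p w fun u => G (u.take ℓ)) fun w => (abs_expectImage_le hp).trans ?_
        conv_rhs => rw [← expectImage_const hsum w 1]
        exact expectImage_mono hp fun u _ => hG _
      rw [← hstep, abs_mul, abs_of_pos hlam0] at h1
      rw [pow_succ, ← div_div, le_div_iff₀ hlam0, mul_comm]
      exact h1
  have hzero : ∀ G : Word → ℝ, (∀ w, |G w| ≤ 1) → D G = 0 := by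
    intro G hG
    have hlim : Tendsto (fun n : ℕ => 2 / inflation m ^ n) atTop (𝓝 0) :=
      (tendsto_pow_atTop_atTop_of_one_lt hlam).const_div_atTop 2
    exact abs_nonpos_iff.1 (ge_of_tendsto' hlim fun n => hbound n G hG)
  have hτ : ∀ w, w.length = ℓ + 1 → Legal m w → w.tail.length = ℓ ∧ Legal m w.tail :=
    fun w hl hw => ⟨by simp; omega, legal_tail hw⟩
  rw [← wordMean_pushforward φ' List.tail hτ]
  congr 1
  ext v
  have h0 := hzero (wordInd (List.ofFn v.1)) fun w => by
    unfold wordInd; split_ifs <;> simp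
  rw [sub_eq_zero.1 h0, wordMean_take hm hp hsum hℓ hφ hφ', wordMean_wordInd]

include hm hp hsum in
theorem wordMean_window {ℓ L k : ℕ} (hℓ : 1 ≤ ℓ) (hk : k + ℓ ≤ L) {φ : LegalWord m ℓ → ℝ}
    {φ' : LegalWord m L → ℝ} (hφ : IsPFVector p ℓ φ) (hφ' : IsPFVector p L φ')
    (F : Word → ℝ) : wordMean φ' (fun w => F (window ℓ k w)) = wordMean φ F := by
  induction L generalizing k with
  | zero => omega
  | succ L ih =>
    by_cases hL : L + 1 = ℓ
    · subst hL
      obtain rfl : k = 0 := by omega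
      have : φ' = φ := (existsUnique_isPFVector hm hp hsum hℓ).unique hφ' hφ
      rw [this]
      refine wordMean_congr _ fun w hl _ => ?_
      rw [window, List.drop_zero, List.take_of_length_le hl.le]
    · obtain ⟨φ'', hφ'', -⟩ := existsUnique_isPFVector hm hp hsum (ℓ := L) (by omega)
      cases k with
      | zero =>
        rw [← ih (k := 0) (by omega) hφ'', ← wordMean_take hm hp hsum (by omega) hφ'' hφ']
        refine wordMean_congr _ fun w hl _ => ?_
        simp only [window, List.drop_zero, List.take_take]
        rw [min_eq_left (by omega)]
      | succ k =>
        rw [← ih (k := k) (by omega) hφ'', ← wordMean_tail hm hp hsum (by omega) hφ'' hφ']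
        refine wordMean_congr _ fun w hl _ => ?_
        cases w with
        | nil => simp at hl
        | cons c t => rw [window_succ_cons, List.tail_cons]

end

section

/-! ### The frequency measure on the hull -/

instance : Nonempty Letter := ⟨.a⟩

/-- The cylinder set in the full shift. -/
def fullCylinder {ℓ : ℕ} (k : ℤ) (v : Fin ℓ → Letter) : Set (ℤ → Letter) :=
  {x | ∀ i : Fin ℓ, x (k + (i : ℤ)) = v i}

theorem isClopen_fullCylinder {ℓ : ℕ} (k : ℤ) (v : Fin ℓ → Letter) :
    IsClopen (fullCylinder k v) := by
  have : fullCylinder k v = ⋂ i : Fin ℓ, (fun x : ℤ → Letter => x (k + (i : ℤ))) ⁻¹' {v i} := by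
    ext x; simp [fullCylinder]
  rw [this]
  exact isClopen_iInter_of_finite fun i => (isClopen_discrete {v i}).preimage (continuous_apply _)

theorem isClosed_hull (m : ℕ) : IsClosed (hull m) := isClosed_sInter fun _ h => h.1

theorem measurableSet_hull (m : ℕ) : MeasurableSet (hull m) := (isClosed_hull m).measurableSet

theorem image_cylinder (m : ℕ) {ℓ : ℕ} (k : ℤ) (v : Fin ℓ → Letter) :
    Subtype.val '' cylinder m k v = fullCylinder k v ∩ hull m := by
  ext x
  constructor
  · rintro ⟨y, hy, rfl⟩; exact ⟨hy, y.2⟩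
  · rintro ⟨h1, h2⟩; exact ⟨⟨x, h2⟩, h1, rfl⟩

theorem measurableSet_cylinder (m : ℕ) {ℓ : ℕ} (k : ℤ) (v : Fin ℓ → Letter) :
    MeasurableSet (cylinder m k v) :=
  measurable_subtype_coe (isClopen_fullCylinder k v).1.measurableSet

/-! ### Uniqueness: the cylinder values determine the measure. -/

section Uniqueness

variable (m : ℕ)

/-- The cylinder sets over the windows `[-n, n]`. -/
def centralCylinders : Set (Set (hull m)) :=
  {s | ∃ (n : ℕ) (v : Fin (2 * n + 1) → Letter), s = cylinder m (-(n : ℤ)) v}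

/-- Central windows are nested, so two central cylinders that meet are nested. This is what makes
them a π-system. -/
theorem cylinder_inter_eq {n n' : ℕ} (h : n ≤ n') (v : Fin (2 * n + 1) → Letter)
    (v' : Fin (2 * n' + 1) → Letter)
    (hne : (cylinder m (-(n : ℤ)) v ∩ cylinder m (-(n' : ℤ)) v').Nonempty) :
    cylinder m (-(n : ℤ)) v ∩ cylinder m (-(n' : ℤ)) v' = cylinder m (-(n' : ℤ)) v' := by
  obtain ⟨x, hx, hx'⟩ := hne
  refine Set.inter_eq_right.2 fun y hy i => ?_
  have h1 := hx i
  have h2 := hx' ⟨i.1 + (n' - n), by omega⟩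
  have h3 := hy ⟨i.1 + (n' - n), by omega⟩
  have e : -(n' : ℤ) + ((i.1 + (n' - n) : ℕ) : ℤ) = -(n : ℤ) + (i.1 : ℤ) := by omega
  simp only [e] at h2 h3
  rw [h3, ← h2, h1]

theorem isPiSystem_centralCylinders : IsPiSystem (centralCylinders m) := by
  rintro _ ⟨n, v, rfl⟩ _ ⟨n', v', rfl⟩ hne
  rcases le_total n n' with h | h
  · exact ⟨n', v', cylinder_inter_eq m h v v' hne⟩
  · rw [Set.inter_comm] at hne ⊢
    exact ⟨n, v, cylinder_inter_eq m h v' v hne⟩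

theorem generateFrom_centralCylinders :
    (inferInstance : MeasurableSpace (hull m)) =
      MeasurableSpace.generateFrom (centralCylinders m) := by
  apply le_antisymm
  · have h : Measurable[MeasurableSpace.generateFrom (centralCylinders m)]
        (Subtype.val : hull m → ℤ → Letter) := by
      refine @measurable_pi_lambda _ _ _ (_) _ _ fun i => ?_
      refine @measurable_to_countable' _ _ _ _ (_) _ fun y => ?_
      have h2 : (fun x : hull m => x.1 i) ⁻¹' {y} =
          ⋃ v : {v : Fin (2 * i.natAbs + 1) → Letter //
            v ⟨(i + i.natAbs).toNat, by omega⟩ = y}, cylinder m (-(i.natAbs : ℤ)) v.1 := by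
        ext x
        have e : -(i.natAbs : ℤ) + ((i + i.natAbs).toNat : ℤ) = i := by omega
        simp only [Set.mem_preimage, Set.mem_singleton_iff, Set.mem_iUnion]
        constructor
        · intro hx
          refine ⟨⟨fun j => x.1 (-(i.natAbs : ℤ) + j), ?_⟩, fun j => rfl⟩
          simp only [e, hx]
        · rintro ⟨⟨v, hv⟩, hx⟩
          have := hx ⟨(i + i.natAbs).toNat, by omega⟩
          simp only [e] at this
          rw [this, hv]
      rw [h2]
      exact MeasurableSet.iUnion fun v => MeasurableSpace.measurableSet_generateFrom ⟨_, _, rfl⟩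
    exact h.comap_le
  · refine MeasurableSpace.generateFrom_le ?_
    rintro _ ⟨n, v, rfl⟩
    exact measurableSet_cylinder m _ v

theorem measure_ext_cylinder {μ ν : Measure (hull m)} [IsFiniteMeasure μ]
    (huniv : μ Set.univ = ν Set.univ)
    (h : ∀ (ℓ : ℕ) (k : ℤ) (v : Fin ℓ → Letter), 1 ≤ ℓ →
      μ (cylinder m k v) = ν (cylinder m k v)) : μ = ν := by
  refine ext_of_generate_finite _ (generateFrom_centralCylinders m)
    (isPiSystem_centralCylinders m) ?_ huniv
  rintro _ ⟨n, v, rfl⟩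
  exact h _ _ _ (by omega)

variable {m} {p : Fin (m + 1) → ℝ}

theorem disjoint_cylinder {ℓ : ℕ} (k : ℤ) {v v' : Fin ℓ → Letter} (h : v ≠ v') :
    Disjoint (cylinder m k v) (cylinder m k v') := by
  rw [Set.disjoint_left]
  intro x hx hx'
  exact h (funext fun i => (hx i).symm.trans (hx' i))

theorem IsPFMeasure.measure_cylinder_legal (hm : 1 ≤ m) (hp : ∀ i, 0 < p i)
    (hsum : ∑ i, p i = 1) {μ : Measure (hull m)} (hμ : IsPFMeasure p μ) {ℓ : ℕ} (hℓ : 1 ≤ ℓ)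
    {φ : LegalWord m ℓ → ℝ} (hφ : IsPFVector p ℓ φ) (k : ℤ) (v : LegalWord m ℓ) :
    μ (cylinder m k v.1) = ENNReal.ofReal (φ v) := by
  obtain ⟨φ', hφ', h⟩ := hμ.cylinder_eq ℓ hℓ
  rw [h, (existsUnique_isPFVector hm hp hsum hℓ).unique hφ hφ']

/-- The disjoint legal cylinders at the same position already carry total mass `∑ φ = 1`. -/
theorem IsPFMeasure.measure_cylinder_illegal {μ : Measure (hull m)} (hμ : IsPFMeasure p μ) {ℓ : ℕ}
    (hℓ : 1 ≤ ℓ) (k : ℤ) {v : Fin ℓ → Letter} (hv : ¬ Legal m (List.ofFn v)) :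
    μ (cylinder m k v) = 0 := by
  obtain ⟨φ, hφ, h⟩ := hμ.cylinder_eq ℓ hℓ
  have := hμ.prob
  have h1 : μ (⋃ w : LegalWord m ℓ, cylinder m k w.1) = 1 := by
    rw [measure_iUnion (fun w w' hw => disjoint_cylinder k fun h => hw (Subtype.ext h))
      fun w => measurableSet_cylinder m k w.1, tsum_fintype]
    simp only [h]
    rw [← ENNReal.ofReal_sum_of_nonneg fun w _ => (hφ.pos w).le, hφ.sum_eq_one, ENNReal.ofReal_one]
  have h2 : μ (⋃ w : LegalWord m ℓ, cylinder m k w.1)ᶜ = 0 :=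
    (prob_compl_eq_zero_iff (MeasurableSet.iUnion fun w : LegalWord m ℓ =>
      measurableSet_cylinder m k w.1)).2 h1
  refine measure_mono_null ?_ h2
  rw [Set.subset_compl_iff_disjoint_right, Set.disjoint_iUnion_right]
  exact fun w => disjoint_cylinder k fun h => hv (h ▸ w.2)

theorem IsPFMeasure.unique (hm : 1 ≤ m) (hp : ∀ i, 0 < p i) (hsum : ∑ i, p i = 1)
    {μ ν : Measure (hull m)} (hμ : IsPFMeasure p μ) (hν : IsPFMeasure p ν) : μ = ν := by
  have := hμ.prob
  have := hν.prob
  refine measure_ext_cylinder m (by simp) fun ℓ k v hℓ => ?_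
  by_cases hv : Legal m (List.ofFn v)
  · obtain ⟨φ, hφ, -⟩ := existsUnique_isPFVector hm hp hsum hℓ
    rw [hμ.measure_cylinder_legal hm hp hsum hℓ hφ k ⟨v, hv⟩,
      hν.measure_cylinder_legal hm hp hsum hℓ hφ k ⟨v, hv⟩]
  · rw [hμ.measure_cylinder_illegal hℓ k hv, hν.measure_cylinder_illegal hℓ k hv]

end Uniqueness

/-! #### Shift invariance -/

section Shift

variable {m : ℕ} {p : Fin (m + 1) → ℝ}

theorem hullShift_apply (x : hull m) (k : ℤ) : (hullShift m x).1 k = x.1 (k + 1) := rfl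

theorem hullShift_symm_apply (x : hull m) (k : ℤ) : ((hullShift m).symm x).1 k = x.1 (k - 1) := rfl

theorem measurable_hullShift : Measurable (hullShift m) :=
  (MeasurableEmbedding.subtype_coe (measurableSet_hull m)).measurable_comp_iff.1
    (measurable_pi_iff.2 fun k => (measurable_pi_apply (k + 1)).comp measurable_subtype_coe)

theorem measurable_hullShift_symm : Measurable (hullShift m).symm :=
  (MeasurableEmbedding.subtype_coe (measurableSet_hull m)).measurable_comp_iff.1
    (measurable_pi_iff.2 fun k => (measurable_pi_apply (k - 1)).comp measurable_subtype_coe)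

/-- The shift on the hull as a measurable equivalence. -/
def hullShiftEquiv (m : ℕ) : hull m ≃ᵐ hull m where
  toEquiv := hullShift m
  measurable_toFun := measurable_hullShift
  measurable_invFun := measurable_hullShift_symm

theorem preimage_cylinder {ℓ : ℕ} (k : ℤ) (v : Fin ℓ → Letter) :
    hullShift m ⁻¹' cylinder m k v = cylinder m (k + 1) v := by
  ext x
  simp only [Set.mem_preimage, cylinder, Set.mem_ofPred_eq, hullShift_apply]
  refine forall_congr' fun i => ?_
  rw [show k + (i : ℤ) + 1 = k + 1 + i by ring]

/-- The prescribed cylinder values do not depend on the position, so the image measure satisfies the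
same conditions and uniqueness applies. -/
theorem IsPFMeasure.measurePreserving (hm : 1 ≤ m) (hp : ∀ i, 0 < p i) (hsum : ∑ i, p i = 1)
    {μ : Measure (hull m)} (hμ : IsPFMeasure p μ) : MeasurePreserving (hullShift m) μ μ := by
  refine ⟨measurable_hullShift, ?_⟩
  have := hμ.prob
  refine IsPFMeasure.unique hm hp hsum ⟨?_, fun ℓ hℓ => ?_⟩ hμ
  · exact Measure.isProbabilityMeasure_map measurable_hullShift.aemeasurable
  · obtain ⟨φ, hφ, h⟩ := hμ.cylinder_eq ℓ hℓ
    refine ⟨φ, hφ, fun k v => ?_⟩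
    rw [Measure.map_apply measurable_hullShift (measurableSet_cylinder m k _), preimage_cylinder, h]

end Shift

/-! #### Existence -/

/-- Such an `x` is itself an accumulation point: its window `[-n, n]` occurs in a realisation of
some level, which is shifted to bring that occurrence to the centre. -/
theorem mem_hull_of_legal {m : ℕ} (hm : 1 ≤ m) {x : ℤ → Letter}
    (hx : ∀ n : ℕ, Legal m (List.ofFn fun i : Fin (2 * n + 1) => x (-(n : ℤ) + (i : ℤ)))) :
    x ∈ hull m := by
  refine Set.mem_sInter.2 fun Y hY => hY.2.2 ?_
  have h1 := fun n => (hx n).eventually hm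
  choose K hK using h1
  -- Levels that are high enough for the `n`-th window and strictly increasing, so that each level
  -- has to serve at most one `n`; unused levels get an arbitrary realisation.
  set k : ℕ → ℕ := fun n => n + ∑ i ∈ Finset.range (n + 1), K i with hk
  have hkmono : StrictMono k := strictMono_nat_of_lt_succ fun n => by
    simp only [hk, Finset.sum_range_succ _ (n + 1)]; omega
  have hkK : ∀ n, K n ≤ k n := fun n => by
    have := Finset.single_le_sum (f := K) (fun _ _ => Nat.zero_le _) (Finset.self_mem_range_succ n)
    simp only [hk]; omega
  have hkn : ∀ n, n ≤ k n := fun n => by simp only [hk]; omega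
  have h3 : ∀ N : ℕ, ∃ (j : ℤ) (u v : Word), u ∈ iterRealisations m N [.a] ∧
      v ∈ iterRealisations m N [.a] ∧ ∀ n, k n = N → ∀ i : ℤ, |i| ≤ n →
        markedLetter u v (i + j) = some (x i) := by
    intro N
    by_cases hN : ∃ n, k n = N
    · obtain ⟨n, rfl⟩ := hN
      obtain ⟨v, hv, s, t, hst⟩ := hK n (k n) (hkK n)
      -- The occurrence starts at position `s.length` of the right half, so the origin of `x` lies
      -- at `s.length + n`.
      refine ⟨s.length + n, v, v, hv, hv, fun n' hn' i hi => ?_⟩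
      obtain rfl := hkmono.injective hn'
      have hi' := abs_le.1 hi
      rw [markedLetter, if_pos (by omega)]
      have e : (i + (s.length + n') + v.length).toNat = v.length + (s.length + (i + n').toNat) := by
        omega
      have hlt : (i + n').toNat < 2 * n' + 1 := by omega
      rw [e, List.getElem?_append_right (by omega), Nat.add_sub_cancel_left, ← hst,
        List.append_assoc, List.getElem?_append_right (by omega), Nat.add_sub_cancel_left,
        List.getElem?_append_left (by simpa using hlt), List.getElem?_ofFn, dif_pos hlt]
      congr 2
      simp only
      omega
    · obtain ⟨u, hu⟩ := iterRealisations_nonempty m N [.a]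
      exact ⟨0, u, u, hu, hu, fun n hn => absurd ⟨n, hn⟩ hN⟩
  choose j u v hu hv h using h3
  refine ⟨j, u, v, fun n => ⟨hu n, hv n⟩, fun r => Filter.frequently_atTop.2 fun a => ?_⟩
  refine ⟨k (max a r.toNat), (le_max_left _ _).trans (hkn _), fun i hi => ?_⟩
  exact h _ _ rfl i (by omega)

section Existence

variable {m : ℕ} {p : Fin (m + 1) → ℝ} (hm : 1 ≤ m) (hp : ∀ i, 0 < p i) (hsum : ∑ i, p i = 1)

/-- A two-sided sequence whose window `[-n, n]` is a given word. -/
def extendWord {n : ℕ} (w : Fin (2 * n + 1) → Letter) (k : ℤ) : Letter :=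
  if h : (k + n).toNat < 2 * n + 1 then w ⟨(k + n).toNat, h⟩ else .a

theorem extendWord_mem_fullCylinder {n ℓ : ℕ} (w : Fin (2 * n + 1) → Letter) {k : ℤ}
    (v : Fin ℓ → Letter) (h1 : -(n : ℤ) ≤ k) (h2 : k + ℓ ≤ n + 1) :
    extendWord w ∈ fullCylinder k v ↔ window ℓ (k + n).toNat (List.ofFn w) = List.ofFn v := by
  have key : ∀ i : Fin ℓ, (k + n).toNat + i.1 < 2 * n + 1 := fun i => by omega
  have h : ∀ i : Fin ℓ, extendWord w (k + (i : ℤ)) = w ⟨(k + n).toNat + i.1, key i⟩ := by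
    intro i
    have e : (k + (i : ℤ) + n).toNat = (k + n).toNat + i.1 := by omega
    unfold extendWord
    simp only [e]
    rw [dif_pos (key i)]
  have hlen : (window ℓ (k + n).toNat (List.ofFn w)).length = ℓ :=
    length_window (by rw [List.length_ofFn]; omega)
  simp only [fullCylinder, Set.mem_ofPred_eq, h]
  constructor
  · intro hx
    refine List.ext_getElem (by rw [hlen, List.length_ofFn]) fun i h1 h2 => ?_
    rw [hlen] at h1
    rw [List.getElem_ofFn, ← hx ⟨i, h1⟩]
    simp [window, -List.ofFn_succ]
  · intro hx i
    have h2 : (window ℓ (k + n).toNat (List.ofFn w))[i.1]'(by omega) =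
        (List.ofFn v)[i.1]'(by simp) := by simp only [hx]
    simpa [window, -List.ofFn_succ] using h2

/-- The finitely supported approximation of the frequency measure on the full shift. -/
def approxMeasure {n : ℕ} (φ : LegalWord m (2 * n + 1) → ℝ) : Measure (ℤ → Letter) :=
  ∑ w, ENNReal.ofReal (φ w) • Measure.dirac (extendWord w.1)

theorem approxMeasure_fullCylinder {n : ℕ} {φ : LegalWord m (2 * n + 1) → ℝ}
    (hφ : ∀ w, 0 ≤ φ w) {ℓ : ℕ} {k : ℤ} (v : Fin ℓ → Letter) (h1 : -(n : ℤ) ≤ k)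
    (h2 : k + ℓ ≤ n + 1) : approxMeasure φ (fullCylinder k v) =
      ENNReal.ofReal (wordMean φ fun w => wordInd (List.ofFn v) (window ℓ (k + n).toNat w)) := by
  classical
  have hnn : ∀ w : LegalWord m (2 * n + 1),
      0 ≤ φ w * wordInd (List.ofFn v) (window ℓ (k + n).toNat (List.ofFn w.1)) := fun w =>
    mul_nonneg (hφ w) (by unfold wordInd; split_ifs <;> simp)
  rw [wordMean, ENNReal.ofReal_sum_of_nonneg fun w _ => hnn w, approxMeasure,
    Measure.finsetSum_apply]
  refine Finset.sum_congr rfl fun w _ => ?_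
  rw [Measure.smul_apply, Measure.dirac_apply' _ (isClopen_fullCylinder k v).1.measurableSet,
    Set.indicator_apply, smul_eq_mul, extendWord_mem_fullCylinder w.1 v h1 h2, wordInd]
  split_ifs <;> simp

theorem isProbabilityMeasure_approxMeasure {n : ℕ} {φ : LegalWord m (2 * n + 1) → ℝ}
    (hφ : ∀ w, 0 ≤ φ w) (h1 : ∑ w, φ w = 1) : IsProbabilityMeasure (approxMeasure φ) := by
  refine ⟨?_⟩
  rw [approxMeasure, Measure.finsetSum_apply]
  simp only [Measure.smul_apply, measure_univ, smul_eq_mul, mul_one]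
  rw [← ENNReal.ofReal_sum_of_nonneg fun w _ => hφ w, h1, ENNReal.ofReal_one]

include hm hp hsum in
-- Probability measures on the compact full shift form a compact space, so the approximations have a
-- limit along an ultrafilter. Cylinders are clopen, hence their masses converge, and by consistency
-- they are already correct once `[-n, n]` contains the window.
theorem exists_full_measure : ∃ μ : ProbabilityMeasure (ℤ → Letter), ∀ (ℓ : ℕ), 1 ≤ ℓ →
    ∀ φ : LegalWord m ℓ → ℝ, IsPFVector p ℓ φ → ∀ (k : ℤ) (v : Fin ℓ → Letter),
      (μ : Measure (ℤ → Letter)) (fullCylinder k v) =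
        ENNReal.ofReal (wordMean φ (wordInd (List.ofFn v))) := by
  choose Φ hΦ using fun n : ℕ =>
    (existsUnique_isPFVector hm hp hsum (ℓ := 2 * n + 1) (by omega)).exists
  set μs : ℕ → ProbabilityMeasure (ℤ → Letter) := fun n => ⟨approxMeasure (Φ n),
    isProbabilityMeasure_approxMeasure (fun w => ((hΦ n).pos w).le) (hΦ n).sum_eq_one⟩ with hμs
  obtain ⟨μ, -, hμ⟩ := isCompact_univ.ultrafilter_le_nhds ((hyperfilter ℕ).map μs) (by simp)
  have hlim : Tendsto μs (hyperfilter ℕ) (𝓝 μ) := hμ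
  refine ⟨μ, fun ℓ hℓ φ hφ k v => ?_⟩
  have h1 := ProbabilityMeasure.tendsto_measure_of_isClopen_of_tendsto hlim
    (isClopen_fullCylinder k v)
  have h2 := (ENNReal.continuous_coe.tendsto _).comp h1
  rw [ProbabilityMeasure.ennreal_coeFn_eq_coeFn_toMeasure] at h2
  refine tendsto_nhds_unique h2 (tendsto_const_nhds.congr' ?_)
  refine Nat.hyperfilter_le_atTop ?_
  filter_upwards [eventually_ge_atTop (k.natAbs + ℓ)] with n hn
  simp only [Function.comp_apply]
  rw [ProbabilityMeasure.ennreal_coeFn_eq_coeFn_toMeasure]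
  change _ = approxMeasure (Φ n) (fullCylinder k v)
  rw [approxMeasure_fullCylinder (fun w => ((hΦ n).pos w).le) v (by omega) (by omega),
    wordMean_window hm hp hsum hℓ (by omega) hφ (hΦ n)]

include hm hp hsum in
theorem exists_isPFMeasure : ∃ μ : Measure (hull m), IsPFMeasure p μ := by
  obtain ⟨μ, hμ⟩ := exists_full_measure hm hp hsum
  have hnull : (μ : Measure (ℤ → Letter)) (hull m)ᶜ = 0 := by
    -- Outside the hull some central window is illegal, and there are only countably many illegal
    -- central cylinders, each of measure zero.
    have hsub : (hull m)ᶜ ⊆ ⋃ n : ℕ, ⋃ v : {v : Fin (2 * n + 1) → Letter // ¬ Legal m (List.ofFn v)},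
        fullCylinder (-(n : ℤ)) v.1 := by
      intro x hx
      by_contra h
      simp only [Set.mem_iUnion, not_exists] at h
      refine hx (mem_hull_of_legal hm fun n => ?_)
      by_contra hn
      exact h n ⟨_, hn⟩ fun i => rfl
    refine measure_mono_null hsub (measure_iUnion_null fun n => measure_iUnion_null fun v => ?_)
    obtain ⟨φ, hφ, -⟩ := existsUnique_isPFVector hm hp hsum (ℓ := 2 * n + 1) (by omega)
    rw [hμ _ (by omega) φ hφ, ENNReal.ofReal_eq_zero]
    refine le_of_eq ?_
    rw [wordMean_congr (G := fun _ => 0) _ fun w _ hw => ?_]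
    · simp [wordMean]
    · rw [wordInd, if_neg]
      rintro rfl
      exact v.2 hw
  have hemb := MeasurableEmbedding.subtype_coe (measurableSet_hull m)
  have hinter : ∀ s : Set (ℤ → Letter), (μ : Measure (ℤ → Letter)) (s ∩ hull m) =
      (μ : Measure (ℤ → Letter)) s := fun s => measure_inter_conull hnull
  refine ⟨(μ : Measure (ℤ → Letter)).comap Subtype.val, ⟨⟨?_⟩, fun ℓ hℓ => ?_⟩⟩
  · rw [hemb.comap_apply, Set.image_univ, Subtype.range_coe, ← Set.univ_inter (hull m), hinter]
    simp
  · obtain ⟨φ, hφ, -⟩ := existsUnique_isPFVector hm hp hsum hℓ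
    refine ⟨φ, hφ, fun k v => ?_⟩
    rw [hemb.comap_apply, image_cylinder, hinter, hμ ℓ hℓ φ hφ, wordMean_wordInd]

end Existence

end

section

/-! ### A variance bound for functions of the image of a word -/

section Variance

variable {m : ℕ} {p : Fin (m + 1) → ℝ} (hp : ∀ i, 0 < p i) (hsum : ∑ i, p i = 1)

include hsum in
theorem expectImage_sq_sub (w : Word) (F : Word → ℝ) (e : ℝ) :
    expectImage p w (fun u => (F u - e) ^ 2) =
      expectImage p w (fun u => (F u - expectImage p w F) ^ 2) + (expectImage p w F - e) ^ 2 := by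
  set a := expectImage p w F with ha
  have h : ∀ u, (F u - e) ^ 2 = (F u - a) ^ 2 + ((2 * (a - e)) * F u + (e ^ 2 - a ^ 2)) :=
    fun u => by ring
  simp only [h]
  rw [expectImage_add, expectImage_add, expectImage_const_mul, expectImage_const hsum, ← ha]
  ring

include hp hsum in
/-- The Efron–Stein inequality: if a change of the image of a single letter changes `F` by at most
`C`, the variance of `F` is at most `C ^ 2` times the number of letters. -/
theorem expectImage_variance_le {w : Word} {F : Word → ℝ} {C : ℝ}
    (hC : ∀ x y y' z : Word, y.length = y'.length → y.length ≤ m + 1 →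
      |F (x ++ y ++ z) - F (x ++ y' ++ z)| ≤ C) :
    expectImage p w (fun u => (F u - expectImage p w F) ^ 2) ≤ C ^ 2 * w.length := by
  induction w generalizing F with
  | nil => simp [expectImage]
  | cons c w ih =>
    have hC' : ∀ n x y y' z : Word, y.length = y'.length → y.length ≤ m + 1 →
        |F (n ++ (x ++ y ++ z)) - F (n ++ (x ++ y' ++ z))| ≤ C := by
      intro n x y y' z h1 h2
      simpa [List.append_assoc] using hC (n ++ x) y y' z h1 h2
    cases c with
    | b =>
      simp only [expectImage]
      refine (ih (F := fun v => F (nms m 0 .b ++ v)) (hC' _)).trans ?_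
      rw [List.length_cons]; push_cast
      nlinarith [sq_nonneg C]
    | a =>
      simp only [expectImage]
      -- Conditional means given the image of the first letter. The variance splits into the
      -- variance of `e`, at most `C ^ 2`, and the mean of the conditional variances, bounded by
      -- induction.
      set e : Fin (m + 1) → ℝ := fun i => expectImage p w fun v => F (nms m i .a ++ v) with he
      have hdiff : ∀ i j, |e i - e j| ≤ C := by
        intro i j
        rw [he]
        simp only
        rw [← expectImage_sub]
        refine (abs_expectImage_le hp).trans ?_
        conv_rhs => rw [← expectImage_const hsum w C]
        refine expectImage_mono hp fun v _ => ?_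
        have := hC [] (nms m i .a) (nms m j .a) v
          (by rw [length_nms (by omega), length_nms (by omega)])
          (by rw [length_nms (by omega)]; rfl)
        simpa using this
      set t : ℝ := ∑ i, p i * e i with ht
      have hdev : ∀ i, (e i - t) ^ 2 ≤ C ^ 2 := by
        intro i
        have h1 : e i - t = ∑ j, p j * (e i - e j) := by
          simp only [mul_sub, Finset.sum_sub_distrib, ← Finset.sum_mul, hsum, one_mul, ht]
        have h2 : |e i - t| ≤ C := by
          rw [h1]
          refine (Finset.abs_sum_le_sum_abs _ _).trans ?_
          rw [← one_mul C, ← hsum, Finset.sum_mul]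
          refine Finset.sum_le_sum fun j _ => ?_
          rw [abs_mul, abs_of_pos (hp j)]
          exact mul_le_mul_of_nonneg_left (hdiff i j) (hp j).le
        exact sq_le_sq' (by linarith [(abs_le.1 h2).1]) (abs_le.1 h2).2
      have hterm : ∀ i : Fin (m + 1), expectImage p w (fun v => (F (nms m i .a ++ v) - t) ^ 2) ≤
          C ^ 2 * (w.length + 1) := by
        intro i
        rw [expectImage_sq_sub hsum w (fun v => F (nms m i .a ++ v))]
        have h1 := ih (F := fun v => F (nms m i .a ++ v)) (hC' _)
        have h2 := hdev i
        rw [mul_add, mul_one]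
        exact add_le_add h1 h2
      calc ∑ i, p i * expectImage p w (fun v => (F (nms m i .a ++ v) - t) ^ 2)
          ≤ ∑ i, p i * (C ^ 2 * (w.length + 1)) :=
            Finset.sum_le_sum fun i _ => mul_le_mul_of_nonneg_left (hterm i) (hp i).le
        _ = C ^ 2 * ((Letter.a :: w).length : ℝ) := by
            rw [← Finset.sum_mul, hsum, one_mul, List.length_cons]; push_cast; rfl

include hp hsum in
theorem expectImage_abs_sub_le {w : Word} {F : Word → ℝ} {C : ℝ} (hC0 : 0 < C) (hw : w ≠ [])
    (hC : ∀ x y y' z : Word, y.length = y'.length → y.length ≤ m + 1 →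
      |F (x ++ y ++ z) - F (x ++ y' ++ z)| ≤ C) :
    expectImage p w (fun u => |F u|) ≤ |expectImage p w F| + C * Real.sqrt w.length := by
  set a := expectImage p w F with ha
  set s := C * Real.sqrt w.length with hs
  have hlen : (0 : ℝ) < w.length := Nat.cast_pos.2 (List.length_pos_iff.2 hw)
  have hs0 : 0 < s := mul_pos hC0 (Real.sqrt_pos.2 hlen)
  have hs2 : s ^ 2 = C ^ 2 * w.length := by rw [hs, mul_pow, Real.sq_sqrt hlen.le]
  -- The inequality `|y| ≤ y² / (2s) + s / 2` replaces Cauchy–Schwarz. As `s ^ 2` bounds the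
  -- variance, each of the two terms costs at most `s / 2` in mean.
  have hpt : ∀ u, |F u| ≤ (2 * s)⁻¹ * (F u - a) ^ 2 + (|a| + s / 2) := by
    intro u
    have h1 : |F u| ≤ |a| + |F u - a| := by
      have := abs_add_le a (F u - a); rwa [add_sub_cancel] at this
    have h2 : |F u - a| ≤ (2 * s)⁻¹ * (F u - a) ^ 2 + s / 2 := by
      rw [← sq_abs (F u - a), inv_mul_eq_div, div_add_div _ _ (by positivity) (by positivity),
        le_div_iff₀ (by positivity)]
      nlinarith [sq_nonneg (|F u - a| - s)]
    linarith
  have h3 := expectImage_mono hp (w := w) (fun u _ => hpt u)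
  rw [expectImage_add, expectImage_const_mul, expectImage_const hsum] at h3
  have h4 := expectImage_variance_le hp hsum (w := w) hC
  rw [← ha, ← hs2] at h4
  have h5 : (2 * s)⁻¹ * expectImage p w (fun u => (F u - a) ^ 2) ≤ s / 2 := by
    rw [inv_mul_eq_div, div_le_iff₀ (by positivity)]
    nlinarith
  linarith

end Variance

/-! ### Sums over the subwords of a word -/

/-- The sum of `f` over the subwords of length `ℓ` at the positions below `K`. -/
def blockSum (ℓ : ℕ) (f : Word → ℝ) (K : ℕ) (u : Word) : ℝ :=
  ∑ k ∈ Finset.range K, f (window ℓ k u)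

theorem abs_blockSum_le {ℓ : ℕ} {f : Word → ℝ} {F : ℝ} (hf : ∀ w, |f w| ≤ F) (K : ℕ) (u : Word) :
    |blockSum ℓ f K u| ≤ F * K := by
  refine (Finset.abs_sum_le_sum_abs _ _).trans ?_
  refine (Finset.sum_le_sum fun k _ => hf (window ℓ k u)).trans ?_
  simp [mul_comm]

theorem abs_blockSum_sub_le {ℓ : ℕ} {f : Word → ℝ} {F : ℝ} (hf : ∀ w, |f w| ≤ F) (i j : ℕ)
    (u : Word) : |blockSum ℓ f i u - blockSum ℓ f j u| ≤ F * |(i : ℝ) - j| := by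
  wlog h : j ≤ i generalizing i j
  · rw [abs_sub_comm, abs_sub_comm (i : ℝ)]
    exact this j i (by omega)
  have hF : 0 ≤ F := (abs_nonneg _).trans (hf [])
  rw [blockSum, blockSum, ← Finset.sum_range_add_sum_Ico _ h, add_sub_cancel_left]
  refine (Finset.abs_sum_le_sum_abs _ _).trans ?_
  refine (Finset.sum_le_sum fun k _ => hf (window ℓ k u)).trans ?_
  have : (0 : ℝ) ≤ (i : ℝ) - j := sub_nonneg.2 (by exact_mod_cast h)
  rw [abs_of_nonneg this]
  simp [Nat.cast_sub h, mul_comm]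

theorem window_window {ℓ L k s : ℕ} (h : k + ℓ ≤ L) (u : Word) :
    window ℓ k (window L s u) = window ℓ (s + k) u := by
  simp only [window, List.drop_take, List.drop_drop, List.take_take]
  rw [min_eq_left (by omega)]

theorem blockSum_window {ℓ L s K : ℕ} (f : Word → ℝ) (h : K + ℓ ≤ L) (u : Word) :
    blockSum ℓ f K (window L s u) = blockSum ℓ f (s + K) u - blockSum ℓ f s u := by
  rw [blockSum, blockSum, blockSum, Finset.sum_range_add, add_sub_cancel_left]
  refine Finset.sum_congr rfl fun k hk => ?_
  rw [window_window]
  have := Finset.mem_range.1 hk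
  omega

theorem abs_blockSum_change_le {ℓ : ℕ} {f : Word → ℝ} {F : ℝ} (hf : ∀ w, |f w| ≤ F) (K : ℕ)
    (x y y' z : Word) (hy : y.length = y'.length) :
    |blockSum ℓ f K (x ++ y ++ z) - blockSum ℓ f K (x ++ y' ++ z)| ≤ 2 * F * (y.length + ℓ) := by
  have hF : 0 ≤ F := (abs_nonneg _).trans (hf [])
  rw [blockSum, blockSum, ← Finset.sum_sub_distrib]
  -- Only windows starting in this interval can meet the changed block; it has at most `y.length +
  -- ℓ` positions, each costing `2 * F`.
  set s : Finset ℕ := Finset.Ico (x.length - ℓ) (x.length + y.length) with hs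
  have hterm : ∀ k, |f (window ℓ k (x ++ y ++ z)) - f (window ℓ k (x ++ y' ++ z))| ≤
      if k ∈ s then 2 * F else 0 := by
    intro k
    split_ifs with hk
    · refine (abs_sub _ _).trans ?_
      linarith [hf (window ℓ k (x ++ y ++ z)), hf (window ℓ k (x ++ y' ++ z))]
    · rw [hs, Finset.mem_Ico, not_and_or, not_le, not_lt] at hk
      rcases hk with hk | hk
      · rw [List.append_assoc, List.append_assoc, window_append (by omega),
          window_append (by omega), sub_self, abs_zero]
      · obtain ⟨k', rfl⟩ := Nat.exists_eq_add_of_le hk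
        have e1 : x.length + y.length = (x ++ y).length := by simp
        have e2 : x.length + y.length = (x ++ y').length := by simp [hy]
        conv_lhs => rw [e1, window_append_right, ← e1, e2, window_append_right]
        simp
  refine (Finset.abs_sum_le_sum_abs _ _).trans ((Finset.sum_le_sum fun k _ => hterm k).trans ?_)
  rw [← Finset.sum_filter, Finset.sum_const, nsmul_eq_mul, mul_comm]
  refine mul_le_mul_of_nonneg_left ?_ (by linarith)
  have h1 : (Finset.filter (· ∈ s) (Finset.range K)).card ≤ s.card :=
    Finset.card_le_card fun k hk => (Finset.mem_filter.1 hk).2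
  have h2 : s.card ≤ y.length + ℓ := by rw [hs, Nat.card_Ico]; omega
  exact_mod_cast h1.trans h2

/-- Group the positions by the letter of `w` in whose image they lie. The number of positions is not
random, and each group contributes the induced map at the window starting at that letter. -/
theorem expectImage_blockSum {m : ℕ} {p : Fin (m + 1) → ℝ} (hsum : ∑ i, p i = 1) {ℓ : ℕ}
    (hℓ : 1 ≤ ℓ) (f : Word → ℝ) {r : ℕ} {w : Word} (hr : r + ℓ ≤ w.length + 1) :
    expectImage p w (blockSum ℓ f (imageLen m (w.take r))) =
      blockSum ℓ (inducedMap p ℓ f) r w := by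
  induction r generalizing w with
  | zero =>
    have h : blockSum ℓ f (imageLen m (w.take 0)) = fun _ => 0 := by ext u; simp [blockSum]
    rw [h, expectImage_const hsum]
    simp [blockSum]
  | succ r ih =>
    cases w with
    | nil => simp at hr; omega
    | cons c t =>
      have hr' : r + ℓ ≤ t.length + 1 := by simp at hr; omega
      have hb : ∀ u : Word, blockSum ℓ f (imageLen m ((c :: t).take (r + 1))) u =
          (∑ k ∈ Finset.range (imageLength m c), f (window ℓ k u)) +
          ∑ k ∈ Finset.range (imageLen m (t.take r)), f (window ℓ (imageLength m c + k) u) := by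
        intro u
        rw [List.take_succ_cons, imageLen_cons, blockSum, Finset.sum_range_add]
      have h1 : expectImage p (c :: t) (fun u => ∑ k ∈ Finset.range (imageLen m (t.take r)),
          f (window ℓ (imageLength m c + k) u)) = blockSum ℓ (inducedMap p ℓ f) r t := by
        rw [← ih hr', ← List.singleton_append, expectImage_append]
        rw [← expectImage_const hsum [c] (expectImage p t _)]
        refine expectImage_congr p fun u hu => congrArg _ (funext fun u' => ?_)
        have : imageLength m c = u.length := by
          have := length_of_mem_realisations hu; simpa using this.symm
        simp only [this, window_append_right, blockSum]
      have h2 : inducedMap p ℓ f (window ℓ 0 (c :: t)) = inducedMap p ℓ f (c :: t) := by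
        have := inducedMap_append p hℓ (w := (c :: t).take ℓ) (by simp; omega)
          ((c :: t).drop ℓ) hsum f
        rw [List.take_append_drop] at this
        exact this.symm
      have h3 : blockSum ℓ (inducedMap p ℓ f) (r + 1) (c :: t) =
          blockSum ℓ (inducedMap p ℓ f) r t + inducedMap p ℓ f (c :: t) := by
        rw [blockSum, Finset.sum_range_succ', h2, blockSum]
        simp only [window_succ_cons]
      rw [h3, ← h1, add_comm (expectImage p (c :: t) _), inducedMap, ← expectImage_add]
      exact congrArg _ (funext hb)

/-! ### Cutting a word at a given weight -/

/-- The number of letters of `w` after which the weight `c` reaches the threshold `N`. -/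
def cut (c : Letter → ℝ) : ℝ → Word → ℕ
  | _, [] => 0
  | N, x :: w => if N ≤ 0 then 0 else cut c (N - c x) w + 1

theorem cut_le_length (c : Letter → ℝ) (N : ℝ) (w : Word) : cut c N w ≤ w.length := by
  induction w generalizing N with
  | nil => simp [cut]
  | cons x w ih =>
    simp only [cut]
    split_ifs
    · omega
    · simpa using ih _

theorem le_weight_take_cut (c : Letter → ℝ) {N : ℝ} {w : Word} (h : N ≤ weight c w) :
    N ≤ weight c (w.take (cut c N w)) := by
  induction w generalizing N with
  | nil => simpa [cut] using h
  | cons x w ih =>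
    simp only [cut]
    split_ifs with hN
    · simpa using hN
    · rw [List.take_succ_cons, weight_cons]
      rw [weight_cons] at h
      have := ih (N := N - c x) (by linarith)
      linarith

theorem weight_take_cut_le {c : Letter → ℝ} {B : ℝ} (hB0 : 0 ≤ B) (hB : ∀ x, c x ≤ B) {N : ℝ}
    (hN : 0 ≤ N) (w : Word) : weight c (w.take (cut c N w)) ≤ N + B := by
  -- The recursion subtracts letter weights of at most `B`, so negative thresholds down to `-B` must
  -- be admitted.
  suffices h : ∀ N : ℝ, -B ≤ N → weight c (w.take (cut c N w)) ≤ N + B from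
    h N (by linarith)
  induction w with
  | nil => intro N hN; simp [cut]; linarith
  | cons x w ih =>
    intro N hN
    simp only [cut]
    split_ifs with h
    · simp; linarith
    · rw [List.take_succ_cons, weight_cons]
      have := ih (N - c x) (by linarith [hB x])
      linarith

theorem mul_length_le_weight {c : Letter → ℝ} {r : ℝ} (hc : ∀ x, r ≤ c x) (w : Word) :
    r * w.length ≤ weight c w := by
  induction w with
  | nil => simp
  | cons x w ih => simp only [List.length_cons, weight_cons]; push_cast; linarith [hc x]

theorem weight_le_mul_length {c : Letter → ℝ} {r : ℝ} (hc : ∀ x, c x ≤ r) (w : Word) :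
    weight c w ≤ r * w.length := by
  induction w with
  | nil => simp
  | cons x w ih => simp only [List.length_cons, weight_cons]; push_cast; linarith [hc x]

theorem abs_sub_le_abs_weight_sub {c : Letter → ℝ} (hc : ∀ x, 1 ≤ c x) {u : Word} {i j : ℕ}
    (hi : i ≤ u.length) (hj : j ≤ u.length) :
    |(i : ℝ) - j| ≤ |weight c (u.take i) - weight c (u.take j)| := by
  wlog h : j ≤ i generalizing i j
  · rw [abs_sub_comm, abs_sub_comm (weight c _)]
    exact this hj hi (by omega)
  have h1 : u.take i = u.take j ++ (u.drop j).take (i - j) := by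
    obtain ⟨d, rfl⟩ := Nat.exists_eq_add_of_le h
    rw [Nat.add_sub_cancel_left, List.take_add]
  have h2 := mul_length_le_weight hc ((u.drop j).take (i - j))
  have h3 : ((u.drop j).take (i - j)).length = i - j := by simp; omega
  rw [h3, one_mul, Nat.cast_sub h] at h2
  have h4 : (0 : ℝ) ≤ (i : ℝ) - j := sub_nonneg.2 (by exact_mod_cast h)
  rw [h1, weight_append, add_sub_cancel_left, abs_of_nonneg h4]
  exact h2.trans (le_abs_self _)

theorem cut_one (N : ℕ) {w : Word} (h : N ≤ w.length) : cut (fun _ => 1) N w = N := by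
  induction w generalizing N with
  | nil => simp at h; simp [cut, h]
  | cons x w ih =>
    cases N with
    | zero => simp [cut]
    | succ N =>
      have h1 : ¬ ((N + 1 : ℕ) : ℝ) ≤ 0 := not_le.2 (by push_cast; positivity)
      rw [cut, if_neg h1]
      push_cast
      rw [add_sub_cancel_right, ih N (by simpa using h)]

end

section

/-! ### Mean ergodicity of the word frequencies -/

section MeanErgodic

variable {m : ℕ} {p : Fin (m + 1) → ℝ}

/-- The mean absolute value of the sum of `f` over the subwords of a random legal word, which is
cut when its weight reaches `N`; the word is weighted by its first letter. -/
def cutMean (ℓ : ℕ) {L : ℕ} (φ : LegalWord m L → ℝ) (c : Letter → ℝ) (N : ℕ) (f : Word → ℝ) : ℝ :=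
  wordMean φ fun w => headWeight (letterVec m) w * |blockSum ℓ f (cut c N w) w|

theorem headWeight_nonneg (hm : 1 ≤ m) (w : Word) : 0 ≤ headWeight (letterVec m) w := by
  cases w with
  | nil => rfl
  | cons c w => exact (letterVec_pos m hm c).le

theorem headWeight_le (hm : 1 ≤ m) (w : Word) : headWeight (letterVec m) w ≤ inflation m := by
  have := inflation_gt_one hm
  cases w with
  | nil => exact (by linarith : (0 : ℝ) ≤ inflation m)
  | cons c w => cases c <;> simp only [headWeight, letterVec] <;> linarith

theorem pullWeight_ge_one (hm : 1 ≤ m) {c : Letter → ℝ} (hc : ∀ x, 1 ≤ c x) (x : Letter) :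
    1 ≤ pullWeight m c x := by
  have h1 : (1 : ℝ) ≤ m := by exact_mod_cast hm
  cases x <;> simp only [pullWeight]
  · nlinarith [hc .a, hc .b]
  · exact hc _

theorem pullWeight_le {c : Letter → ℝ} {B : ℕ} (hB : ∀ x, c x ≤ B) (x : Letter) :
    pullWeight m c x ≤ ((m + 1) * B : ℕ) := by
  have h0 : (0 : ℝ) ≤ m := Nat.cast_nonneg m
  have hB0 : (0 : ℝ) ≤ B := Nat.cast_nonneg B
  push_cast
  cases x <;> simp only [pullWeight]
  · nlinarith [hB .a, hB .b]
  · nlinarith [hB .a]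

theorem imageLength_le (m : ℕ) (c : Letter) : imageLength m c ≤ m + 1 := by
  cases c <;> simp [imageLength]

theorem abs_inducedMap_le (hp : ∀ i, 0 < p i) (hsum : ∑ i, p i = 1) {ℓ : ℕ} {f : Word → ℝ}
    {F : ℝ} (hf : ∀ w, |f w| ≤ F) (w : Word) : |inducedMap p ℓ f w| ≤ F * (m + 1) := by
  have hF : 0 ≤ F := (abs_nonneg _).trans (hf [])
  cases w with
  | nil => simp only [inducedMap, abs_zero]; positivity
  | cons c w =>
    refine (abs_expectImage_le hp).trans ?_
    conv_rhs => rw [← expectImage_const hsum (c :: w) (F * (m + 1))]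
    refine expectImage_mono hp fun u _ => ?_
    refine (abs_blockSum_le hf (imageLength m c) u).trans (mul_le_mul_of_nonneg_left ?_ hF)
    exact_mod_cast imageLength_le m c

/-- Comparison of the cut sum over a shifted window of an image with the sum over the image of a
cut word. -/
theorem abs_blockSum_cut_sub_le {ℓ L N : ℕ} {f : Word → ℝ} {F : ℝ} {c : Letter → ℝ} {B : ℕ}
    (hm : 1 ≤ m)
    (hf : ∀ w, |f w| ≤ F) (hc : ∀ x, 1 ≤ c x) (hB : ∀ x, c x ≤ B) {w u : Word}
    (hw : L = w.length) (hL : N + (m + 1) * B + ℓ ≤ L) (hu : u ∈ realisations m w) {k : ℕ}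
    (hk : k ≤ m + 1) (hkL : k + L ≤ u.length) :
    |blockSum ℓ f (cut c N (window L k u)) (window L k u) -
      blockSum ℓ f (imageLen m (w.take (cut (pullWeight m c) N w))) u| ≤
        F * ((m + 1) + 3 * (m + 1) * B) := by
  have hF : 0 ≤ F := (abs_nonneg _).trans (hf [])
  have hB1 : (1 : ℝ) ≤ B := (hc .a).trans (hB .a)
  have hm0 : (0 : ℝ) ≤ m := Nat.cast_nonneg m
  have hN0 : (0 : ℝ) ≤ N := Nat.cast_nonneg N
  have hkr : (k : ℝ) ≤ m + 1 := by exact_mod_cast hk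
  have hLr : (N : ℝ) + (m + 1) * B + ℓ ≤ L := by exact_mod_cast hL
  have hℓ0 : (0 : ℝ) ≤ ℓ := Nat.cast_nonneg ℓ
  set y := window L k u with hy
  have hylen : y.length = L := length_window hkL
  set q := cut c N y with hq
  set r := cut (pullWeight m c) N w with hr
  set K := imageLen m (w.take r) with hK
  have hqL : q ≤ L := hylen ▸ cut_le_length c N y
  have hyN : (N : ℝ) ≤ weight c y := by
    have := mul_length_le_weight hc y
    rw [hylen] at this
    nlinarith
  have hq1 : (N : ℝ) ≤ weight c (y.take q) := le_weight_take_cut c hyN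
  have hq2 : weight c (y.take q) ≤ N + B := weight_take_cut_le (by linarith) hB hN0 y
  have hqlen : (q : ℝ) ≤ N + B := by
    have := mul_length_le_weight hc (y.take q)
    rw [List.length_take, hylen, min_eq_left hqL] at this
    linarith
  have hc' := pullWeight_ge_one hm hc
  have hB' : ∀ x, pullWeight m c x ≤ (m + 1) * B := fun x => by
    have := pullWeight_le (m := m) hB x; push_cast at this; exact this
  have hwN : (N : ℝ) ≤ weight (pullWeight m c) w := by
    have := mul_length_le_weight hc' w
    rw [← hw] at this
    nlinarith
  have hr1 : (N : ℝ) ≤ weight (pullWeight m c) (w.take r) := le_weight_take_cut _ hwN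
  have hr2 : weight (pullWeight m c) (w.take r) ≤ N + (m + 1) * B :=
    weight_take_cut_le (by positivity) hB' hN0 w
  obtain ⟨u₁, hu₁, u₂, -, hu12⟩ := realisations_append.1
    (show u ∈ realisations m (w.take r ++ w.drop r) by rwa [List.take_append_drop])
  have hKu : u.take K = u₁ := by
    rw [hu12, hK, ← length_of_mem_realisations hu₁, List.take_left']; rfl
  have hKlen : K ≤ u.length := by
    rw [hu12, hK, ← length_of_mem_realisations hu₁]; simp
  have hKw : weight c (u.take K) = weight (pullWeight m c) (w.take r) := by
    rw [hKu, weight_of_mem_realisations c hu₁]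
  have hkq : weight c (u.take (k + q)) = weight c (u.take k) + weight c (y.take q) := by
    rw [List.take_add, weight_append, hy, window, List.take_take, min_eq_left hqL]
  have hk0 : 0 ≤ weight c (u.take k) := by
    have := mul_length_le_weight (r := 0) (fun x => zero_le_one.trans (hc x)) (u.take k)
    linarith
  have hkB : weight c (u.take k) ≤ (m + 1) * B := by
    have h1 := weight_le_mul_length hB (u.take k)
    rw [List.length_take, min_eq_left (by omega)] at h1
    nlinarith
  -- Both prefixes of `u` have weight `N` up to the skipped `k` letters, at most `(m + 1) * B`, and
  -- the overshoots of the two cuts, at most `B` and `(m + 1) * B`. Letters weigh at least `1`, so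
  -- positions differ by no more than weights.
  have hdist : |((k + q : ℕ) : ℝ) - K| ≤ 3 * (m + 1) * B := by
    refine (abs_sub_le_abs_weight_sub hc (u := u) (by omega) hKlen).trans ?_
    rw [hkq, hKw, abs_le]
    constructor <;> nlinarith
  have hqℓ : q + ℓ ≤ L := by
    have h1 : (q : ℝ) + ℓ ≤ L := by nlinarith
    exact_mod_cast h1
  rw [hy, blockSum_window f hqℓ]
  have h1 := abs_blockSum_sub_le hf (k + q) K u (ℓ := ℓ)
  have h2 := abs_blockSum_le hf k u (ℓ := ℓ)
  have h3 := mul_le_mul_of_nonneg_left hdist hF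
  have h4 := mul_le_mul_of_nonneg_left hkr hF
  have h5 := abs_sub (blockSum ℓ f (k + q) u - blockSum ℓ f K u) (blockSum ℓ f k u)
  have h6 : blockSum ℓ f (k + q) u - blockSum ℓ f k u - blockSum ℓ f K u =
    blockSum ℓ f (k + q) u - blockSum ℓ f K u - blockSum ℓ f k u := by ring
  rw [h6]
  nlinarith

variable (hm : 1 ≤ m) (hp : ∀ i, 0 < p i) (hsum : ∑ i, p i = 1)

include hm hp hsum in
/-- One step of the renormalisation by the random substitution. -/
theorem cutMean_le_step {ℓ : ℕ} (hℓ : 1 ≤ ℓ) {f : Word → ℝ} {F : ℝ} (hf : ∀ w, |f w| ≤ F)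
    {c : Letter → ℝ} {B : ℕ} (hc : ∀ x, 1 ≤ c x) (hB : ∀ x, c x ≤ B) :
    ∃ C, 0 ≤ C ∧ ∀ (N L : ℕ), N + (m + 1) * B + ℓ ≤ L → ∀ φ : LegalWord m L → ℝ,
      IsPFVector p L φ → cutMean ℓ φ c N f ≤
        cutMean ℓ φ (pullWeight m c) N (inducedMap p ℓ f) + C * Real.sqrt L := by
  have hF : 0 ≤ F := (abs_nonneg _).trans (hf [])
  have hlam := inflation_gt_one hm
  have hlam0 : 0 < inflation m := by linarith
  -- `C₁` is the boundary error of the cut and `C₂` bounds the effect of changing the image of one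
  -- letter; the summand `1` keeps `C₂` positive if `F = 0`.
  set C₁ : ℝ := F * ((m + 1) + 3 * (m + 1) * B) with hC₁
  set C₂ : ℝ := 2 * F * ((m + 1) + ℓ) + 1 with hC₂
  have hC₁0 : 0 ≤ C₁ := by positivity
  have hC₂0 : 0 < C₂ := by positivity
  refine ⟨inflation m * (C₁ + C₂), by positivity, fun N L hL φ hφ => ?_⟩
  have hL1 : 1 ≤ L := by omega
  have hsq : 1 ≤ Real.sqrt L := Real.one_le_sqrt.2 (by exact_mod_cast hL1)
  set c' := pullWeight m c with hc'def
  set g := inducedMap p ℓ f with hg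
  have hpt : ∀ w : Word, w.length = L → Legal m w →
      inducedMap p L (fun w => headWeight (letterVec m) w * |blockSum ℓ f (cut c N w) w|) w ≤
        inflation m * (headWeight (letterVec m) w * |blockSum ℓ g (cut c' N w) w| +
          inflation m * (C₁ + C₂) * Real.sqrt L) := by
    intro w hwL hw
    set r := cut c' N w with hr
    set K := imageLen m (w.take r) with hK
    have hne : w ≠ [] := by rw [← List.length_pos_iff]; omega
    have hrℓ : r + ℓ ≤ w.length + 1 := by
      have h1 : (r : ℝ) ≤ N + (m + 1) * B := by
        have h2 := mul_length_le_weight (pullWeight_ge_one hm hc) (w.take r)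
        rw [List.length_take, min_eq_left (cut_le_length _ _ _), one_mul] at h2
        refine h2.trans (weight_take_cut_le (by positivity) (fun x => ?_) (Nat.cast_nonneg N) w)
        have := pullWeight_le (m := m) hB x; push_cast at this; exact this
      have h2 : r ≤ N + (m + 1) * B := by exact_mod_cast h1
      omega
    have hfluct : expectImage p w (fun u => |blockSum ℓ f K u|) ≤
        |blockSum ℓ g r w| + C₂ * Real.sqrt L := by
      have h1 := expectImage_abs_sub_le hp hsum (w := w) (F := blockSum ℓ f K) hC₂0 hne
        (fun x y y' z h1 h2 => (abs_blockSum_change_le hf K x y y' z h1).trans (by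
          have : (y.length : ℝ) ≤ m + 1 := by exact_mod_cast h2
          have := mul_le_mul_of_nonneg_left this (by positivity : 0 ≤ 2 * F)
          rw [hC₂]; nlinarith))
      rwa [expectImage_blockSum hsum hℓ f hrℓ, hwL] at h1
    cases hwc : w with
    | nil => exact absurd hwc hne
    | cons x t =>
      rw [← hwc]
      have h1 : inducedMap p L
          (fun w => headWeight (letterVec m) w * |blockSum ℓ f (cut c N w) w|) w ≤
          expectImage p w (fun u => (inflation m * headWeight (letterVec m) w) *
            (|blockSum ℓ f K u| + C₁)) := by
        rw [hwc, inducedMap, ← hwc]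
        refine expectImage_mono hp fun u hu => ?_
        have hu' : u ∈ realisations m (x :: t) := hwc ▸ hu
        -- The head weights sum to `λ` times the head weight of `w` for every realisation. This is
        -- the purpose of the weighting: the factor `λ` cancels against the eigenvalue at the end.
        have h2 : ∑ k ∈ Finset.range (imageLength m x), headWeight (letterVec m) (window L k u) =
            inflation m * headWeight (letterVec m) w := by
          obtain ⟨i, hi, v, hv, rfl⟩ := hu'
          rw [← length_nms hi, sum_headWeight_window hL1, weight_nms hi, pullWeight_letterVec, hwc]
          rfl
        rw [← h2, Finset.sum_mul]
        refine Finset.sum_le_sum fun k hk => ?_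
        have hk' := Finset.mem_range.1 hk
        refine mul_le_mul_of_nonneg_left ?_ (headWeight_nonneg hm _)
        have h3 := abs_blockSum_cut_sub_le hm hf hc hB hwL.symm hL hu (k := k)
          (hk'.le.trans (imageLength_le m x))
          (window_fits hu' hk' (by rw [← hwL, hwc]; simp))
        have h4 := abs_sub_abs_le_abs_sub (blockSum ℓ f (cut c N (window L k u)) (window L k u))
          (blockSum ℓ f K u)
        linarith
      refine h1.trans ?_
      rw [expectImage_const_mul, expectImage_add, expectImage_const hsum, mul_assoc]
      refine mul_le_mul_of_nonneg_left ?_ hlam0.le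
      have h5 := headWeight_nonneg hm w
      have h6 := headWeight_le hm w
      have h7 : expectImage p w (fun u => |blockSum ℓ f K u|) + C₁ ≤
          |blockSum ℓ g r w| + (C₁ + C₂) * Real.sqrt L := by nlinarith
      refine (mul_le_mul_of_nonneg_left h7 h5).trans ?_
      rw [mul_add]
      refine add_le_add_right ?_ _
      rw [mul_assoc]
      exact mul_le_mul_of_nonneg_right h6 (by positivity)
  have h1 := hφ.wordMean_inducedMap
    (fun w => headWeight (letterVec m) w * |blockSum ℓ f (cut c N w) w|)
  have h2 := wordMean_mono (fun v => (hφ.pos v).le) hpt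
  rw [h1, wordMean_const_mul, wordMean_add, wordMean_const hφ.sum_eq_one] at h2
  exact le_of_mul_le_mul_left h2 hlam0

include hm hp hsum in
-- The bounds on `f` and `c` deteriorate with each step, but for fixed `n` they do not depend on `N`
-- or `L`, so the accumulated error remains a constant times `√L`.
theorem cutMean_le_iterate {ℓ : ℕ} (hℓ : 1 ≤ ℓ) (n : ℕ) : ∀ {f : Word → ℝ} {F : ℝ},
    (∀ w, |f w| ≤ F) → ∀ {c : Letter → ℝ} {B : ℕ}, (∀ x, 1 ≤ c x) → (∀ x, c x ≤ B) →
    ∃ (C : ℝ) (D : ℕ), 0 ≤ C ∧ ∀ (N L : ℕ), N + D ≤ L → ∀ φ : LegalWord m L → ℝ,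
      IsPFVector p L φ → cutMean ℓ φ c N f ≤
        cutMean ℓ φ ((pullWeight m)^[n] c) N ((inducedMap p ℓ)^[n] f) + C * Real.sqrt L := by
  induction n with
  | zero => exact fun _ _ _ _ _ => ⟨0, 0, le_rfl, fun N L _ φ _ => by simp⟩
  | succ n ih =>
    intro f F hf c B hc hB
    obtain ⟨C₁, hC₁, h₁⟩ := cutMean_le_step hm hp hsum hℓ hf hc hB
    obtain ⟨C₂, D, hC₂, h₂⟩ := ih (abs_inducedMap_le hp hsum hf (ℓ := ℓ))
      (pullWeight_ge_one hm hc) (pullWeight_le (m := m) hB)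
    refine ⟨C₁ + C₂, D + ((m + 1) * B + ℓ), by positivity, fun N L hL φ hφ => ?_⟩
    have h3 := h₁ N L (by omega) φ hφ
    have h4 := h₂ N L (by omega) φ hφ
    rw [Function.iterate_succ_apply, Function.iterate_succ_apply, add_mul]
    linarith

theorem iterate_inducedMap {ℓ : ℕ} (f : Word → ℝ) (n : ℕ) (w : LegalWord m ℓ) :
    (inducedMap p ℓ)^[n] f (List.ofFn w.1) =
      ∑ v : LegalWord m ℓ, f (List.ofFn v.1) * (inducedMatrix p ℓ ^ n) v w := by
  induction n generalizing w with
  | zero => simp [Matrix.one_apply]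
  | succ n ih =>
    rw [Function.iterate_succ_apply', ← sum_mul_inducedMatrix]
    simp only [ih, pow_succ, Matrix.mul_apply, Finset.mul_sum, Finset.sum_mul]
    rw [Finset.sum_comm]
    exact Finset.sum_congr rfl fun v _ => Finset.sum_congr rfl fun w' _ => by ring

/-- Pulling back is monotone and multiplies `letterVec` by `λ`. -/
theorem le_iterate_pullWeight (n : ℕ) {c : Letter → ℝ} {r : ℝ} (hc : ∀ x, r * letterVec m x ≤ c x)
    (x : Letter) : r * inflation m ^ n * letterVec m x ≤ (pullWeight m)^[n] c x := by
  induction n generalizing c r with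
  | zero => simpa using hc x
  | succ n ih =>
    rw [Function.iterate_succ_apply, pow_succ', ← mul_assoc]
    refine ih fun y => ?_
    rw [mul_assoc, ← pullWeight_letterVec]
    cases y
    · simp only [pullWeight]
      have h1 := mul_le_mul_of_nonneg_left (hc .a) (Nat.cast_nonneg (α := ℝ) m)
      have h2 := hc .b
      linarith
    · exact hc .a

include hm in
theorem one_le_iterate_pullWeight (n : ℕ) : ∀ {c : Letter → ℝ}, (∀ x, 1 ≤ c x) →
    ∀ x, 1 ≤ (pullWeight m)^[n] c x := by
  induction n with
  | zero => exact fun h => h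
  | succ n ih => exact fun h => by simpa using ih (pullWeight_ge_one hm h)

theorem exists_le_iterate_pullWeight (n : ℕ) : ∀ {c : Letter → ℝ} {B : ℕ}, (∀ x, c x ≤ B) →
    ∃ B' : ℕ, ∀ x, (pullWeight m)^[n] c x ≤ B' := by
  induction n with
  | zero => exact fun hB => ⟨_, hB⟩
  | succ n ih => exact fun hB => by simpa using ih (pullWeight_le (m := m) hB)

include hm hp hsum in
theorem wordMean_abs_blockSum_le {ℓ : ℕ} (hℓ : 1 ≤ ℓ) {φ : LegalWord m ℓ → ℝ}
    (hφ : IsPFVector p ℓ φ) {f : Word → ℝ} {F : ℝ} (hf : ∀ w, |f w| ≤ F)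
    (hmean : wordMean φ f = 0) {ε : ℝ} (hε : 0 < ε) : ∃ D : ℕ, ℓ ≤ D ∧ ∀ᶠ N : ℕ in atTop,
      ∀ φ' : LegalWord m (N + D) → ℝ, IsPFVector p (N + D) φ' →
        wordMean φ' (fun w => |blockSum ℓ f N w|) ≤ ε * N := by
  have hlam := inflation_gt_one hm
  have hlam0 : 0 < inflation m := by linarith
  -- The main term will be at most `λ² * δ * (N + B)` with `B ≤ N`, hence at most `ε / 2 * N`.
  set δ : ℝ := ε / (4 * inflation m ^ 2) with hδ
  have hδ0 : 0 < δ := by positivity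
  -- The limiting rank-one projection annihilates a function of mean zero, so its transposed
  -- iterates are `o(λⁿ)` on the finitely many legal words.
  obtain ⟨n, hn⟩ : ∃ n : ℕ, ∀ w : LegalWord m ℓ,
      |(inducedMap p ℓ)^[n] f (List.ofFn w.1)| ≤ δ * inflation m ^ n := by
    obtain ⟨φ₀, hφ₀, C, -, hlim⟩ := exists_isPFVector_tendsto hm hp hsum hℓ
    have hφφ : φ₀ = φ := (existsUnique_isPFVector hm hp hsum hℓ).unique hφ₀ hφ
    subst hφφ
    have h1 : ∀ w : LegalWord m ℓ, ∀ᶠ n : ℕ in atTop,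
        |(inducedMap p ℓ)^[n] f (List.ofFn w.1)| ≤ δ * inflation m ^ n := by
      intro w
      have h2 := hlim (fun v => f (List.ofFn v.1)) w
      have h3 : ∑ v, φ₀ v * f (List.ofFn v.1) = 0 := hmean
      rw [h3, zero_mul, zero_div] at h2
      filter_upwards [h2.eventually (Metric.ball_mem_nhds 0 hδ0)] with n h4
      have h5 : dist ((inducedMap p ℓ)^[n] f (List.ofFn w.1) / inflation m ^ n) 0 < δ := by
        rw [iterate_inducedMap]; exact h4
      rw [Real.dist_eq, sub_zero, abs_div, abs_of_pos (pow_pos hlam0 n), div_lt_iff₀ (pow_pos hlam0 n)] at h5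
      exact h5.le
    exact (eventually_all.2 h1).exists
  obtain ⟨C, D, hC, hstep⟩ := cutMean_le_iterate hm hp hsum hℓ n hf
    (c := fun _ => 1) (B := 1) (fun _ => le_rfl) (fun _ => by simp)
  obtain ⟨B, hB⟩ := exists_le_iterate_pullWeight (m := m) n (c := fun _ => 1) (B := 1) (by simp)
  set c' := (pullWeight m)^[n] (fun _ => 1) with hc'
  set g := (inducedMap p ℓ)^[n] f with hg
  -- After `n` pullbacks each letter weighs at least `λⁿ / λ`, so a prefix cut at weight `N` has at
  -- most about `λ * N / λⁿ` letters. This offsets the size `δ * λⁿ` of `g`.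
  have hlow : ∀ x, inflation m ^ n / inflation m ≤ c' x := by
    intro x
    have h1 := le_iterate_pullWeight n (c := fun _ => 1) (r := (inflation m)⁻¹) (fun y => by
      rw [inv_mul_le_iff₀ hlam0, mul_one]
      cases y <;> simp only [letterVec] <;> linarith) x
    have h2 : 1 ≤ letterVec m x := by cases x <;> simp only [letterVec] <;> linarith
    rw [div_eq_inv_mul]
    exact (le_mul_of_one_le_right (by positivity) h2).trans h1
  have hone : ∀ x, 1 ≤ c' x := one_le_iterate_pullWeight hm n fun _ => le_rfl
  refine ⟨D + B + ℓ, by omega, ?_⟩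
  -- The conditions give `N + B ≤ 2N`, word length at most `2N`, and `C * √(2N) ≤ ε / 2 * N`,
  -- respectively.
  filter_upwards [eventually_ge_atTop B, eventually_ge_atTop (D + B + ℓ),
    eventually_ge_atTop (Nat.ceil ((4 * C / ε) ^ 2))] with N hNB hND hNC φ' hφ'
  have hfirst : wordMean φ' (fun w => |blockSum ℓ f N w|) ≤ cutMean ℓ φ' (fun _ => 1) N f := by
    refine wordMean_mono (fun v => (hφ'.pos v).le) fun w hw _ => ?_
    rw [cut_one N (by omega)]
    refine le_mul_of_one_le_left (abs_nonneg _) ?_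
    cases w with
    | nil => simp at hw; omega
    | cons x t => cases x <;> simp only [headWeight, letterVec] <;> linarith
  have hlast : cutMean ℓ φ' c' N g ≤ inflation m * (inflation m * δ * (N + B)) := by
    conv_rhs => rw [← wordMean_const hφ'.sum_eq_one (inflation m * (inflation m * δ * (N + B)))]
    refine wordMean_mono (fun v => (hφ'.pos v).le) fun w hw hleg => ?_
    refine mul_le_mul (headWeight_le hm w) ?_ (abs_nonneg _) hlam0.le
    set q := cut c' N w with hq
    have hqw := weight_take_cut_le (c := c') (Nat.cast_nonneg B) hB (Nat.cast_nonneg (α := ℝ) N) w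
    have hqlen : (w.take q).length = q := by
      rw [List.length_take, min_eq_left (cut_le_length _ _ _)]
    have h1 := mul_length_le_weight hone (w.take q)
    have h2 := mul_length_le_weight hlow (w.take q)
    rw [hqlen] at h1 h2
    have h3 : q ≤ N + B := by
      have : (q : ℝ) ≤ N + B := by linarith
      exact_mod_cast this
    have h4 : |blockSum ℓ g q w| ≤ q * (δ * inflation m ^ n) := by
      refine (Finset.abs_sum_le_sum_abs _ _).trans ?_
      rw [← nsmul_eq_mul, ← Finset.card_range q, ← Finset.sum_const, Finset.card_range]
      refine Finset.sum_le_sum fun k hk => ?_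
      have hk' := Finset.mem_range.1 hk
      have := hn (toLegal (window ℓ k w) (length_window (by omega))
        (hleg.of_infix (window_infix _ _ _)))
      rwa [ofFn_toLegal] at this
    refine h4.trans ?_
    have h5 : (q : ℝ) * inflation m ^ n ≤ inflation m * (N + B) := by
      have h6 := h2.trans hqw
      rw [div_mul_eq_mul_div, div_le_iff₀ hlam0] at h6
      linarith
    have h7 := mul_le_mul_of_nonneg_left h5 hδ0.le
    linarith
  have hsecond := hstep N (N + (D + B + ℓ)) (by omega) φ' hφ'
  have hN0 : (0 : ℝ) ≤ N := Nat.cast_nonneg N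
  have hNB' : (B : ℝ) ≤ N := by exact_mod_cast hNB
  have hmain : inflation m * (inflation m * δ * (N + B)) ≤ ε / 2 * N := by
    have : inflation m * (inflation m * δ * (N + B)) = ε / 4 * (N + B) := by
      rw [hδ]; field_simp
    rw [this]
    nlinarith
  have hroot : C * Real.sqrt ((N + (D + B + ℓ) : ℕ) : ℝ) ≤ ε / 2 * N := by
    have h1 : Real.sqrt ((N + (D + B + ℓ) : ℕ) : ℝ) ≤ Real.sqrt (2 * N) := by
      refine Real.sqrt_le_sqrt ?_
      have : ((D + B + ℓ : ℕ) : ℝ) ≤ N := by exact_mod_cast hND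
      rw [Nat.cast_add]; linarith
    have h2 : 4 * C / ε ≤ Real.sqrt (2 * N) := by
      refine Real.le_sqrt_of_sq_le ?_
      have := (Nat.le_ceil _).trans (Nat.cast_le (α := ℝ).2 hNC)
      linarith
    rw [div_le_iff₀ hε] at h2
    have h3 : Real.sqrt (2 * N) * Real.sqrt (2 * N) = 2 * N :=
      Real.mul_self_sqrt (by positivity)
    have h4 := mul_le_mul_of_nonneg_left h1 hC
    have h5 := mul_le_mul_of_nonneg_right h2 (Real.sqrt_nonneg (2 * (N : ℝ)))
    nlinarith
  linarith

end MeanErgodic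

end

section

/-! ### The pointwise ergodic theorem for ergodic transformations -/

section Birkhoff

variable {X : Type*}

/-- The maximum of `0` and the first `n` Birkhoff sums. -/
def maxBirkhoff (T : X → X) (f : X → ℝ) : ℕ → X → ℝ
  | 0, _ => 0
  | n + 1, x => max 0 (f x + maxBirkhoff T f n (T x))

theorem maxBirkhoff_nonneg (T : X → X) (f : X → ℝ) (n : ℕ) (x : X) : 0 ≤ maxBirkhoff T f n x := by
  cases n
  · exact le_rfl
  · exact le_max_left _ _

theorem maxBirkhoff_mono (T : X → X) (f : X → ℝ) (x : X) :
    Monotone fun n => maxBirkhoff T f n x := by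
  refine monotone_nat_of_le_succ fun n => ?_
  induction n generalizing x with
  | zero => exact maxBirkhoff_nonneg T f 1 x
  | succ n ih => exact max_le_max le_rfl (by linarith [ih (T x)])

theorem birkhoffSum_le_maxBirkhoff (T : X → X) (f : X → ℝ) (n : ℕ) (x : X) :
    birkhoffSum T f n x ≤ maxBirkhoff T f n x := by
  induction n generalizing x with
  | zero => simp [maxBirkhoff]
  | succ n ih =>
    rw [birkhoffSum_succ']
    exact le_trans (by linarith [ih (T x)]) (le_max_right _ _)

theorem birkhoffSum_sub_const (T : X → X) (f : X → ℝ) (c : ℝ) (n : ℕ) (x : X) :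
    birkhoffSum T (fun x => f x - c) n x = birkhoffSum T f n x - n * c := by
  simp [birkhoffSum, Finset.sum_sub_distrib]

variable [MeasurableSpace X] {μ : Measure X} {T : X → X}

theorem measurable_maxBirkhoff (hT : Measurable T) {f : X → ℝ} (hf : Measurable f) (n : ℕ) :
    Measurable (maxBirkhoff T f n) := by
  induction n with
  | zero => exact measurable_const
  | succ n ih => exact measurable_const.max (hf.add (ih.comp hT))

theorem integrable_maxBirkhoff (hT : MeasurePreserving T μ μ) {f : X → ℝ} (hf : Integrable f μ)
    (n : ℕ) : Integrable (maxBirkhoff T f n) μ := by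
  induction n with
  | zero => exact integrable_zero _ _ _
  | succ n ih => exact (integrable_zero X ℝ μ).sup (hf.add (hT.integrable_comp_of_integrable ih))

variable [IsProbabilityMeasure μ]

/-- The set `E` where the maximal function is infinite is invariant, so it is null or of full
measure. In the second case `D n = max (-Mₙ ∘ T) f` tends to `f` almost everywhere, dominated by
`|f|`. But `∫ D n = ∫ Mₙ₊₁ - ∫ Mₙ ≥ 0` by invariance of `μ`, which contradicts `∫ f < 0`. -/
theorem ae_bddAbove_birkhoffSum (hT : Ergodic T μ) {f : X → ℝ} (hfm : Measurable f)
    (hf : Integrable f μ) (hneg : ∫ x, f x ∂μ < 0) :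
    ∀ᵐ x ∂μ, ∃ C, ∀ n, birkhoffSum T f n x ≤ C := by
  set E : Set X := {x | ∀ C : ℕ, ∃ n, (C : ℝ) < maxBirkhoff T f n x} with hE
  have hEm : MeasurableSet E := by
    have : E = ⋂ C : ℕ, ⋃ n, {x | (C : ℝ) < maxBirkhoff T f n x} := by ext x; simp [hE]
    rw [this]
    exact MeasurableSet.iInter fun C => MeasurableSet.iUnion fun n =>
      measurableSet_lt measurable_const (measurable_maxBirkhoff hT.measurable hfm n)
  have hTE : T ⁻¹' E = E := by
    ext x
    simp only [hE, Set.mem_preimage, Set.mem_ofPred_eq]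
    constructor
    · intro h C
      obtain ⟨C', hC'⟩ := exists_nat_ge (C - f x)
      obtain ⟨n, hn⟩ := h C'
      exact ⟨n + 1, lt_max_of_lt_right (by linarith)⟩
    · intro h C
      obtain ⟨C', hC'⟩ := exists_nat_ge (C + f x)
      obtain ⟨n, hn⟩ := h C'
      have h0 : (0 : ℝ) ≤ C' := Nat.cast_nonneg _
      cases n with
      | zero => exact absurd hn (not_lt.2 h0)
      | succ n =>
        refine ⟨n, ?_⟩
        rcases lt_max_iff.1 hn with h1 | h1
        · exact absurd h1 (not_lt.2 h0)
        · linarith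
  rcases hT.toPreErgodic.prob_eq_zero_or_one hEm hTE with h0 | h1
  · filter_upwards [measure_eq_zero_iff_ae_notMem.1 h0] with x hx
    simp only [hE, Set.mem_ofPred_eq, not_forall, not_exists, not_lt] at hx
    obtain ⟨C, hC⟩ := hx
    exact ⟨C, fun n => (birkhoffSum_le_maxBirkhoff T f n x).trans (hC n)⟩
  · exfalso
    have hae : ∀ᵐ x ∂μ, x ∈ E := (mem_ae_iff_prob_eq_one hEm).2 h1
    set D : ℕ → X → ℝ := fun n x => maxBirkhoff T f (n + 1) x - maxBirkhoff T f n (T x) with hD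
    have hDeq : ∀ n x, D n x = max (-maxBirkhoff T f n (T x)) (f x) := by
      intro n x
      simp only [hD, maxBirkhoff]
      rw [← max_sub_sub_right, zero_sub, add_sub_cancel_right]
    have hint := integrable_maxBirkhoff hT.toMeasurePreserving hf
    have hDint : ∀ n, 0 ≤ ∫ x, D n x ∂μ := by
      intro n
      have hcomp : ∫ x, maxBirkhoff T f n (T x) ∂μ = ∫ x, maxBirkhoff T f n x ∂μ := by
        have := integral_map (μ := μ) hT.measurable.aemeasurable
          (f := maxBirkhoff T f n) (by rw [hT.map_eq]; exact (hint n).aestronglyMeasurable)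
        rw [hT.map_eq] at this
        exact this.symm
      simp only [hD]
      rw [integral_sub (hint (n + 1))
        (g := fun x => maxBirkhoff T f n (T x))
        (hT.toMeasurePreserving.integrable_comp_of_integrable (hint n)), hcomp, sub_nonneg]
      exact integral_mono (hint n) (hint (n + 1)) fun x => maxBirkhoff_mono T f x n.le_succ
    have hlim : Tendsto (fun n => ∫ x, D n x ∂μ) atTop (𝓝 (∫ x, f x ∂μ)) := by
      refine tendsto_integral_of_dominated_convergence (fun x => |f x|) (fun n => ?_) hf.abs
        (fun n => Eventually.of_forall fun x => ?_) ?_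
      · exact ((hint (n + 1)).sub
          (hT.toMeasurePreserving.integrable_comp_of_integrable (hint n))).aestronglyMeasurable
      · rw [hDeq, Real.norm_eq_abs, abs_le]
        refine ⟨(neg_abs_le _).trans (le_max_right _ _), max_le ?_ (le_abs_self _)⟩
        linarith [maxBirkhoff_nonneg T f n (T x), abs_nonneg (f x)]
      · filter_upwards [hae] with x hx
        rw [← hTE] at hx
        obtain ⟨C, hC⟩ := exists_nat_ge (-f x)
        obtain ⟨n, hn⟩ := hx C
        refine tendsto_const_nhds.congr' ?_
        filter_upwards [eventually_ge_atTop n] with k hk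
        have := maxBirkhoff_mono T f (T x) hk
        simp only at this
        rw [hDeq, max_eq_right (by linarith)]
    have := ge_of_tendsto' hlim hDint
    linarith

theorem ae_eventually_birkhoffSum_lt (hT : Ergodic T μ) {f : X → ℝ} (hfm : Measurable f)
    (hf : Integrable f μ) {ε : ℝ} (hε : 0 < ε) :
    ∀ᵐ x ∂μ, ∀ᶠ n : ℕ in atTop, birkhoffSum T f n x / n < ∫ x, f x ∂μ + ε := by
  -- Subtracting slightly more than the mean makes the integral negative, so the Birkhoff sums of `f
  -- - c` are bounded above and vanish in the upper limit after division by `n`.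
  set c := ∫ x, f x ∂μ + ε / 2 with hc
  have h := ae_bddAbove_birkhoffSum hT (f := fun x => f x - c) (hfm.sub_const c)
    (hf.sub (integrable_const c)) (by
      rw [integral_sub hf (integrable_const c), integral_const]
      simp [hc]; linarith)
  filter_upwards [h] with x ⟨C, hC⟩
  have hlim : Tendsto (fun n : ℕ => C / (n : ℝ)) atTop (𝓝 0) := tendsto_const_div_atTop_nhds_zero_nat C
  filter_upwards [hlim.eventually (gt_mem_nhds (half_pos hε)), eventually_gt_atTop 0] with n h1 h2
  have h3 := hC n
  rw [birkhoffSum_sub_const] at h3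
  have h4 : (0 : ℝ) < n := Nat.cast_pos.2 h2
  have h5 : birkhoffSum T f n x / n ≤ C / n + c := by
    rw [div_add' _ _ _ h4.ne']
    exact div_le_div_of_nonneg_right (by linarith) h4.le
  linarith

theorem ae_tendsto_birkhoffSum_of_measurable (hT : Ergodic T μ) {f : X → ℝ} (hfm : Measurable f)
    (hf : Integrable f μ) :
    ∀ᵐ x ∂μ, Tendsto (fun n : ℕ => birkhoffSum T f n x / n) atTop (𝓝 (∫ x, f x ∂μ)) := by
  have h1 : ∀ k : ℕ, ∀ᵐ x ∂μ, ∀ᶠ n : ℕ in atTop,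
      birkhoffSum T f n x / n < ∫ x, f x ∂μ + 1 / ((k : ℝ) + 1) := fun k =>
    ae_eventually_birkhoffSum_lt hT hfm hf (by positivity)
  have h2 : ∀ k : ℕ, ∀ᵐ x ∂μ, ∀ᶠ n : ℕ in atTop,
      birkhoffSum T (fun x => -f x) n x / n < ∫ x, -f x ∂μ + 1 / ((k : ℝ) + 1) := fun k =>
    ae_eventually_birkhoffSum_lt hT hfm.neg hf.neg (by positivity)
  filter_upwards [ae_all_iff.2 h1, ae_all_iff.2 h2] with x hx1 hx2
  rw [Metric.tendsto_atTop']
  intro ε hε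
  obtain ⟨k, hk⟩ := exists_nat_one_div_lt hε
  obtain ⟨n₀, hn₀⟩ := eventually_atTop.1 ((hx1 k).and (hx2 k))
  refine ⟨n₀, fun n hn => ?_⟩
  obtain ⟨h3, h4⟩ := hn₀ n hn.le
  have h5 : birkhoffSum T (fun x => -f x) n x = -birkhoffSum T f n x := by
    simp [birkhoffSum]
  rw [h5, integral_neg, neg_div] at h4
  rw [Real.dist_eq, abs_lt]
  constructor <;> linarith

/-- Birkhoff's pointwise ergodic theorem for an ergodic transformation. -/
theorem ae_tendsto_birkhoffSum (hT : Ergodic T μ) {f : X → ℝ} (hf : Integrable f μ) :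
    ∀ᵐ x ∂μ, Tendsto (fun n : ℕ => birkhoffSum T f n x / n) atTop (𝓝 (∫ x, f x ∂μ)) := by
  obtain ⟨g, hg, hfg⟩ := hf.aestronglyMeasurable
  have h1 : ∀ i : ℕ, ∀ᵐ x ∂μ, f (T^[i] x) = g (T^[i] x) := fun i =>
    (hT.toMeasurePreserving.iterate i).quasiMeasurePreserving.ae hfg
  have h2 := ae_tendsto_birkhoffSum_of_measurable hT hg.measurable (hf.congr hfg)
  rw [← integral_congr_ae hfg] at h2
  filter_upwards [ae_all_iff.2 h1, h2] with x hx h3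
  simpa only [birkhoffSum, hx] using h3

/-- Birkhoff's pointwise ergodic theorem for real- or complex-valued functions. -/
theorem ae_tendsto_birkhoffSum_rclike {𝕜 : Type*} [RCLike 𝕜] (hT : Ergodic T μ) {f : X → 𝕜}
    (hf : Integrable f μ) : ∀ᵐ x ∂μ,
      Tendsto (fun n : ℕ => (1 / (n : 𝕜)) * birkhoffSum T f n x) atTop (𝓝 (∫ x, f x ∂μ)) := by
  filter_upwards [ae_tendsto_birkhoffSum hT hf.re, ae_tendsto_birkhoffSum hT hf.im] with x h1 h2
  have h3 : ∫ x, f x ∂μ = ((∫ x, RCLike.re (f x) ∂μ : ℝ) : 𝕜) +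
      ((∫ x, RCLike.im (f x) ∂μ : ℝ) : 𝕜) * RCLike.I := (integral_re_add_im hf).symm
  rw [h3]
  have h4 := ((RCLike.continuous_ofReal (K := 𝕜)).tendsto _).comp h1
  have h5 := ((RCLike.continuous_ofReal (K := 𝕜)).tendsto _).comp h2
  refine (h4.add (h5.mul_const RCLike.I)).congr fun n => ?_
  simp only [Function.comp_apply, birkhoffSum, RCLike.ofReal_div, RCLike.ofReal_sum,
    RCLike.ofReal_natCast]
  rw [div_mul_eq_mul_div, ← add_div, Finset.sum_mul, ← Finset.sum_add_distrib]
  simp only [RCLike.re_add_im]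
  rw [one_div_mul_eq_div]

end Birkhoff

end

section

/-! ### Ergodicity of the frequency measure -/

/-- The word of length `L` at position `0`. -/
def readWord {m : ℕ} (L : ℕ) (x : hull m) : Word := List.ofFn fun i : Fin L => x.1 (i : ℤ)

theorem window_readWord {m ℓ L k : ℕ} (h : k + ℓ ≤ L) (x : hull m) :
    window ℓ k (readWord L x) = List.ofFn fun i : Fin ℓ => x.1 ((k : ℤ) + (i : ℤ)) := by
  have hlen : (window ℓ k (readWord L x)).length = ℓ :=
    length_window (by rw [readWord, List.length_ofFn]; omega)
  refine List.ext_getElem (by rw [hlen, List.length_ofFn]) fun i h1 h2 => ?_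
  simp [window, readWord]

theorem readWord_eq_iff {m L : ℕ} (x : hull m) (v : Fin L → Letter) :
    readWord L x = List.ofFn v ↔ x ∈ cylinder m 0 v := by
  rw [readWord, List.ofFn_inj]
  simp [cylinder, funext_iff]

theorem wordInd_window_readWord {m ℓ L k : ℕ} (h : k + ℓ ≤ L) (v : Fin ℓ → Letter) (x : hull m) :
    wordInd (List.ofFn v) (window ℓ k (readWord L x)) =
      (cylinder m k v).indicator (fun _ => (1 : ℝ)) x := by
  classical
  rw [window_readWord h, wordInd, Set.indicator_apply]
  exact if_congr (by rw [List.ofFn_inj, funext_iff]; rfl) rfl rfl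

section Ergodicity

variable {m : ℕ} {p : Fin (m + 1) → ℝ} (hm : 1 ≤ m) (hp : ∀ i, 0 < p i) (hsum : ∑ i, p i = 1)
  {μ : Measure (hull m)} (hμ : IsPFMeasure p μ)

include hμ in
theorem IsPFMeasure.ae_legal_readWord {L : ℕ} (hL : 1 ≤ L) :
    ∀ᵐ x ∂μ, Legal m (readWord L x) := by
  have h : ∀ᵐ x ∂μ, ∀ v : {v : Fin L → Letter // ¬ Legal m (List.ofFn v)},
      x ∉ cylinder m 0 v.1 := by
    refine ae_all_iff.2 fun v => ?_
    exact measure_eq_zero_iff_ae_notMem.1 (hμ.measure_cylinder_illegal hL 0 v.2)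
  filter_upwards [h] with x hx
  by_contra hleg
  exact hx ⟨_, hleg⟩ fun i => by simp

include hm hp hsum hμ in
theorem IsPFMeasure.integral_readWord {L : ℕ} (hL : 1 ≤ L) {φ : LegalWord m L → ℝ}
    (hφ : IsPFVector p L φ) (F : Word → ℝ) :
    ∫ x, F (readWord L x) ∂μ = wordMean φ F := by
  classical
  have := hμ.prob
  have h : (fun x => F (readWord L x)) =ᵐ[μ] fun x => ∑ v : LegalWord m L,
      (cylinder m 0 v.1).indicator (fun _ => F (List.ofFn v.1)) x := by
    filter_upwards [hμ.ae_legal_readWord hL] with x hx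
    rw [← sum_legalWord_ite (ℓ := L) (by simp [readWord]) hx F]
    refine Finset.sum_congr rfl fun v _ => ?_
    rw [Set.indicator_apply]
    exact if_congr (readWord_eq_iff x v.1) rfl rfl
  rw [integral_congr_ae h, integral_finsetSum _ fun v _ =>
    (integrable_const _).indicator (measurableSet_cylinder m 0 _)]
  refine Finset.sum_congr rfl fun v _ => ?_
  rw [integral_indicator_const _ (measurableSet_cylinder m 0 _), Measure.real,
    hμ.measure_cylinder_legal hm hp hsum hL hφ, ENNReal.toReal_ofReal (hφ.pos v).le, smul_eq_mul]

theorem measurable_readWord_comp (L : ℕ) (F : Word → ℝ) :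
    Measurable fun x : hull m => F (readWord L x) := by
  have h1 : Measurable fun x : hull m => fun i : Fin L => x.1 (i : ℤ) :=
    measurable_pi_iff.2 fun i => (measurable_pi_apply _).comp measurable_subtype_coe
  exact (measurable_of_countable fun v : Fin L → Letter => F (List.ofFn v)).comp h1

theorem integrable_readWord_comp [IsFiniteMeasure μ] (L : ℕ) (F : Word → ℝ) :
    Integrable (fun x : hull m => F (readWord L x)) μ := by
  obtain ⟨C, hC⟩ := (Set.finite_range fun v : Fin L → Letter => |F (List.ofFn v)|).bddAbove
  exact Integrable.of_bound (measurable_readWord_comp L F).aestronglyMeasurable C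
    (Eventually.of_forall fun x => hC ⟨_, rfl⟩)

include hm hp hsum hμ in
theorem IsPFMeasure.measure_cylinder_inter {B : Set (hull m)} (hB : MeasurableSet B)
    (hinv : hullShift m ⁻¹' B = B) {ℓ : ℕ} (k : ℤ) (v : Fin ℓ → Letter) :
    μ (cylinder m k v ∩ B) = μ (cylinder m 0 v ∩ B) := by
  have hstep : ∀ k : ℤ, μ (cylinder m (k + 1) v ∩ B) = μ (cylinder m k v ∩ B) := by
    intro k
    rw [← (hμ.measurePreserving hm hp hsum).measure_preimage
      ((measurableSet_cylinder m k v).inter hB).nullMeasurableSet, Set.preimage_inter,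
      preimage_cylinder, hinv]
  induction k with
  | zero => rfl
  | succ k ih => rw [hstep, ih]
  | pred k ih => rw [← ih, ← hstep, sub_add_cancel]

include hm hp hsum hμ in
-- For the centred indicator `f` of `v`, each shifted copy has the same integral over the invariant
-- set `B`, so the integral of the sum of `N` copies is `N` times the defect. The law of large
-- numbers bounds it by `ε * N`.
theorem IsPFMeasure.measure_cylinder_inter_eq_mul {B : Set (hull m)} (hB : MeasurableSet B)
    (hinv : hullShift m ⁻¹' B = B) {ℓ : ℕ} (hℓ : 1 ≤ ℓ) (v : LegalWord m ℓ) :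
    μ.real (cylinder m 0 v.1 ∩ B) = μ.real (cylinder m 0 v.1) * μ.real B := by
  have := hμ.prob
  obtain ⟨φ, hφ, -⟩ := existsUnique_isPFVector hm hp hsum hℓ
  have hφv : μ.real (cylinder m 0 v.1) = φ v := by
    rw [Measure.real, hμ.measure_cylinder_legal hm hp hsum hℓ hφ,
      ENNReal.toReal_ofReal (hφ.pos v).le]
  rw [hφv]
  set f : Word → ℝ := fun w => wordInd (List.ofFn v.1) w - φ v with hf
  have hmean : wordMean φ f = 0 := by
    rw [hf, wordMean_sub, wordMean_wordInd, wordMean_const hφ.sum_eq_one, sub_self]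
  have hbound : ∀ w, |f w| ≤ 1 + |φ v| := fun w => by
    refine (abs_sub _ _).trans (add_le_add_left ?_ _)
    unfold wordInd; split_ifs <;> simp
  refine eq_of_abs_sub_le_all fun ε hε => ?_
  obtain ⟨D, hD, hev⟩ := wordMean_abs_blockSum_le hm hp hsum hℓ hφ hbound hmean hε
  obtain ⟨N, hN, hN0⟩ := (hev.and (eventually_gt_atTop 0)).exists
  obtain ⟨φ', hφ', -⟩ := existsUnique_isPFVector hm hp hsum (ℓ := N + D) (by omega)
  have h1 := hN φ' hφ'
  rw [← hμ.integral_readWord hm hp hsum (by omega) hφ'] at h1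
  have h2 : ∫ x in B, blockSum ℓ f N (readWord (N + D) x) ∂μ =
      N * (μ.real (cylinder m 0 v.1 ∩ B) - φ v * μ.real B) := by
    have h3 : ∀ x : hull m, blockSum ℓ f N (readWord (N + D) x) = ∑ k ∈ Finset.range N,
        ((cylinder m k v.1).indicator (fun _ => (1 : ℝ)) x - φ v) := by
      intro x
      refine Finset.sum_congr rfl fun k hk => ?_
      have := Finset.mem_range.1 hk
      rw [hf]
      simp only
      rw [wordInd_window_readWord (by omega)]
    have hint : ∀ k : ℤ, Integrable ((cylinder m k v.1).indicator fun _ => (1 : ℝ))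
        (μ.restrict B) := fun k =>
      (integrable_const _).indicator (measurableSet_cylinder m k _)
    simp only [h3]
    rw [integral_finsetSum (f := fun (k : ℕ) x =>
      (cylinder m (k : ℤ) v.1).indicator (fun _ => (1 : ℝ)) x - φ v) _
      fun k _ => (hint k).sub (integrable_const _)]
    have h4 : ∀ k ∈ Finset.range N, ∫ x in B, ((cylinder m k v.1).indicator (fun _ => (1 : ℝ)) x -
        φ v) ∂μ = μ.real (cylinder m 0 v.1 ∩ B) - φ v * μ.real B := by
      intro k _
      rw [integral_sub (hint k) (integrable_const _),
        integral_indicator_const _ (measurableSet_cylinder m k _), setIntegral_const, smul_eq_mul,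
        smul_eq_mul, mul_one, mul_comm, measureReal_restrict_apply (measurableSet_cylinder m k _)]
      exact congrArg (· - _) (congrArg ENNReal.toReal
        (hμ.measure_cylinder_inter hm hp hsum hB hinv k v.1))
    rw [Finset.sum_congr rfl h4, Finset.sum_const, Finset.card_range, nsmul_eq_mul]
  have h5 : |∫ x in B, blockSum ℓ f N (readWord (N + D) x) ∂μ| ≤ ε * N := by
    refine (abs_integral_le_integral_abs).trans (le_trans ?_ h1)
    exact setIntegral_le_integral (integrable_readWord_comp (N + D) fun w => |blockSum ℓ f N w|)
      (Eventually.of_forall fun x => abs_nonneg _)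
  have hN' : (0 : ℝ) < N := Nat.cast_pos.2 hN0
  rw [h2, abs_mul, abs_of_pos hN', mul_comm] at h5
  exact le_of_mul_le_mul_right h5 hN'

include hm hp hsum hμ in
-- Independence of `B` from cylinders extends to all measurable sets because cylinders determine
-- finite measures. Independence of `B` from itself leaves only measure `0` or `1`.
theorem IsPFMeasure.ergodic : Ergodic (hullShift m) μ := by
  have := hμ.prob
  refine ⟨hμ.measurePreserving hm hp hsum, ⟨fun B hB hinv => ?_⟩⟩
  have hext : μ.restrict B = μ B • μ := by
    refine measure_ext_cylinder m (by simp) fun ℓ k v hℓ => ?_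
    rw [Measure.restrict_apply (measurableSet_cylinder m k v), Measure.smul_apply, smul_eq_mul]
    by_cases hv : Legal m (List.ofFn v)
    · have h1 := hμ.measure_cylinder_inter_eq_mul hm hp hsum hB hinv hℓ ⟨v, hv⟩
      rw [hμ.measure_cylinder_inter hm hp hsum hB hinv]
      have h2 := hμ.measure_cylinder_inter hm hp hsum MeasurableSet.univ Set.preimage_univ k v
      rw [Set.inter_univ, Set.inter_univ] at h2
      rw [h2]
      rw [Measure.real, Measure.real, Measure.real, ← ENNReal.toReal_mul,
        ENNReal.toReal_eq_toReal_iff' (measure_ne_top _ _)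
          (ENNReal.mul_ne_top (measure_ne_top _ _) (measure_ne_top _ _))] at h1
      rw [h1, mul_comm]
    · have h0 := hμ.measure_cylinder_illegal hℓ k hv
      rw [h0, mul_zero]
      exact measure_mono_null Set.inter_subset_left h0
  have hsq : μ B = μ B * μ B := by
    have := congrArg (fun ν : Measure (hull m) => ν B) hext
    simpa using this
  rw [eventuallyConst_set']
  by_cases h0 : μ B = 0
  · exact Or.inl (ae_eq_empty.2 h0)
  · right
    have h1 : μ B = 1 := by
      have h2 : μ B * 1 = μ B * μ B := by rw [mul_one]; exact hsq
      exact ((ENNReal.mul_right_inj h0 (measure_ne_top _ _)).1 h2).symm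
    exact ae_eq_univ.2 ((prob_compl_eq_zero_iff hB).2 h1)

/-! ### Averages from an arbitrary starting point and word frequencies. -/

theorem hullShift_zpow_apply (i : ℤ) (x : hull m) (k : ℤ) :
    ((hullShift m ^ i) x).1 k = x.1 (k + i) := by
  induction i generalizing x k with
  | zero => simp
  | succ i ih =>
    rw [zpow_add_one, Equiv.Perm.mul_apply, ih, hullShift_apply]
    exact congrArg x.1 (by ring)
  | pred i ih =>
    rw [zpow_sub_one, Equiv.Perm.mul_apply, ih]
    exact (hullShift_symm_apply x _).trans (congrArg x.1 (by ring))

include hm hp hsum hμ in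
theorem IsPFMeasure.measurePreserving_zpow (i : ℤ) : MeasurePreserving (hullShift m ^ i) μ μ := by
  have h := hμ.measurePreserving hm hp hsum
  have h' : MeasurePreserving ⇑(hullShift m)⁻¹ μ μ :=
    MeasurePreserving.symm (hullShiftEquiv m) h
  induction i with
  | zero => exact MeasurePreserving.id μ
  | succ i ih => rw [zpow_add_one, Equiv.Perm.coe_mul]; exact ih.comp h
  | pred i ih => rw [zpow_sub_one, Equiv.Perm.coe_mul]; exact ih.comp h'

theorem sum_Icc_shift {M : Type*} [AddCommMonoid M] (s : ℤ) (N : ℕ) (g : ℤ → M) :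
    ∑ i ∈ Finset.Icc s ((N : ℤ) + s - 1), g i = ∑ j ∈ Finset.range N, g (s + j) := by
  symm
  refine Finset.sum_nbij' (fun j : ℕ => s + (j : ℤ)) (fun i : ℤ => (i - s).toNat) ?_ ?_ ?_ ?_ ?_
  · intro j hj; simp only [Finset.mem_range, Finset.mem_Icc] at *; omega
  · intro i hi; simp only [Finset.mem_range, Finset.mem_Icc] at *; omega
  · intro j _; simp
  · intro i hi; simp only [Finset.mem_Icc] at hi; omega
  · intro j _; rfl

include hm hp hsum hμ in
-- Birkhoff's theorem is applied to `f ∘ Sˢ`, which has the same integral as `f`; this absorbs the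
-- starting point `s`.
theorem IsPFMeasure.ae_tendsto_average {𝕜 : Type*} [RCLike 𝕜] {f : hull m → 𝕜}
    (hf : Integrable f μ) (s : ℤ) : ∀ᵐ x ∂μ, Tendsto (fun N : ℕ =>
      (1 / (N : 𝕜)) * ∑ i ∈ Finset.Icc s ((N : ℤ) + s - 1), f ((hullShift m ^ i) x))
      atTop (𝓝 (∫ x, f x ∂μ)) := by
  have := hμ.prob
  have hs := hμ.measurePreserving_zpow hm hp hsum s
  have hint : ∫ x, f ((hullShift m ^ s) x) ∂μ = ∫ x, f x ∂μ := by
    have := integral_map (μ := μ) hs.measurable.aemeasurable (f := f)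
      (by rw [hs.map_eq]; exact hf.aestronglyMeasurable)
    rw [hs.map_eq] at this
    exact this.symm
  filter_upwards [ae_tendsto_birkhoffSum_rclike (hμ.ergodic hm hp hsum)
    (hs.integrable_comp_of_integrable hf)] with x hx
  simp only [Function.comp_apply] at hx
  rw [hint] at hx
  refine hx.congr fun N => ?_
  rw [sum_Icc_shift]
  congr 1
  refine Finset.sum_congr rfl fun j _ => ?_
  simp only [Function.comp_apply]
  rw [zpow_add, Equiv.Perm.mul_apply, zpow_natCast, Equiv.Perm.coe_pow]

include hm hp hsum hμ in
theorem IsPFMeasure.ae_tendsto_frequency {ℓ : ℕ} (hℓ : 1 ≤ ℓ) {φ : LegalWord m ℓ → ℝ}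
    (hφ : IsPFVector p ℓ φ) (v : LegalWord m ℓ) (s : ℤ) : ∀ᵐ x ∂μ, Tendsto (fun N : ℕ =>
      (((Finset.Icc s ((N : ℤ) + s - 1)).filter
        (fun i : ℤ => ∀ j : Fin ℓ, x.1 (i + (j : ℤ)) = v.1 j)).card : ℝ) / (N : ℝ))
      atTop (𝓝 (φ v)) := by
  classical
  have := hμ.prob
  have hint : Integrable ((cylinder m 0 v.1).indicator fun _ => (1 : ℝ)) μ :=
    (integrable_const _).indicator (measurableSet_cylinder m 0 _)
  have hval : ∫ x, (cylinder m 0 v.1).indicator (fun _ => (1 : ℝ)) x ∂μ = φ v := by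
    rw [integral_indicator_const _ (measurableSet_cylinder m 0 _), Measure.real,
      hμ.measure_cylinder_legal hm hp hsum hℓ hφ, ENNReal.toReal_ofReal (hφ.pos v).le, smul_eq_mul,
      mul_one]
  filter_upwards [hμ.ae_tendsto_average hm hp hsum hint s] with x hx
  rw [hval] at hx
  refine hx.congr fun N => ?_
  rw [one_div_mul_eq_div, Finset.card_filter, Nat.cast_sum]
  congr 1
  refine Finset.sum_congr rfl fun i _ => ?_
  have h : (hullShift m ^ i) x ∈ cylinder m 0 v.1 ↔ ∀ j : Fin ℓ, x.1 (i + (j : ℤ)) = v.1 j := by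
    simp only [cylinder, Set.mem_ofPred_eq, hullShift_zpow_apply]
    refine forall_congr' fun j => ?_
    rw [show (0 : ℤ) + j + i = i + j by ring]
  rw [Set.indicator_apply]
  simp only [h, Nat.cast_ite, Nat.cast_one, Nat.cast_zero]

end Ergodicity

end

end RNMS

end

open RNMS
theorem theorem1 {𝕜 : Type*} [RCLike 𝕜] (m : ℕ) (hm : 1 ≤ m) (p : Fin (m + 1) → ℝ)
    (hp : ∀ i, 0 < p i) (hsum : ∑ i, p i = 1) :
    (∀ ℓ : ℕ, 1 ≤ ℓ → ∃! φ : LegalWord m ℓ → ℝ, IsPFVector p ℓ φ) ∧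
    (∃! μ : Measure (hull m), IsPFMeasure p μ) ∧
    ∀ μ : Measure (hull m), IsPFMeasure p μ →
      MeasurePreserving (hullShift m) μ μ ∧
      (∀ f : hull m → 𝕜, Integrable f μ → ∀ s : ℤ, ∀ᵐ x ∂μ,
        Tendsto (fun N : ℕ =>
            (1 / (N : 𝕜)) * ∑ i ∈ Finset.Icc s ((N : ℤ) + s - 1), f ((hullShift m ^ i) x))
          atTop (𝓝 (∫ x, f x ∂μ))) ∧
      (∀ ℓ : ℕ, 1 ≤ ℓ → ∀ φ : LegalWord m ℓ → ℝ, IsPFVector p ℓ φ →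
        ∀ (v : LegalWord m ℓ) (s : ℤ), ∀ᵐ x ∂μ,
          Tendsto (fun N : ℕ =>
              (((Finset.Icc s ((N : ℤ) + s - 1)).filter
                (fun i : ℤ => ∀ j : Fin ℓ, x.1 (i + (j : ℤ)) = v.1 j)).card : ℝ) / (N : ℝ))
            atTop (𝓝 (φ v))) := by
  obtain ⟨μ₀, hμ₀⟩ := exists_isPFMeasure hm hp hsum
  exact ⟨fun ℓ hℓ => existsUnique_isPFVector hm hp hsum hℓ,
    ⟨μ₀, hμ₀, fun μ hμ => hμ.unique hm hp hsum hμ₀⟩,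
    fun μ hμ => ⟨hμ.measurePreserving hm hp hsum,
      fun f hf s => hμ.ae_tendsto_average hm hp hsum hf s,
      fun ℓ hℓ φ hφ v s => hμ.ae_tendsto_frequency hm hp hsum hℓ hφ v s⟩⟩
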